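/- Let $\ell>0$. A smooth solution $\gamma:\mathbb{R}\times(\mathbb{R}/\ell\mathbb{Z})\to\mathbb{R}^3$ of the binormal curvature flow is a smooth map with $|\partial_s\gamma(t,s)|=1$ and $$\partial_t\gamma=\partial_s\gamma\times\partial_{ss}\gamma$$ for all $t\in\mathbb{R}$, $s\in\mathbb{R}/\ell\mathbb{Z}$; with it are associated, for each $t\in\mathbb{R}$, the distributions (currents) $$T_{\gamma,t}(X):=\int_0^\ell X(\gamma(t,s))\cdot\partial_s\gamma(t,s)\,ds,\qquad X\in\mathcal{D}(\mathbb{R}^3,\mathbb{R}^3).$$ Let $\gamma:\mathbb{R}\times(\mathbb{R}/\ell\mathbb{Z})\to\mathbb{R}^3$ be such a smooth solution that is a traveling circle at speed $\frac{2\pi}{\ell}$, i.e. $\gamma(t,s)=\gamma(0,s)+\frac{2\pi}{\ell}\,t\,\vec e$, where $\vec e$ is a unit vector and $\gamma(0,\cdot)$ parametrizes a circle of radius $r=\frac{\ell}{2\pi}$ in a plane perpendicular to $\vec e$. For $m>1$ set $a_m:=\frac12\left(\frac3m-m\right)$. Then for every $m>1$ there exist numbers $\ell_n>0$ and smooth solutions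 $\gamma_n:\mathbb{R}\times(\mathbb{R}/\ell_n\mathbb{Z})\to\mathbb{R}^3$, $n\in\mathbb{N}$, of the binormal curvature flow such that $\ell_n\to m\ell$ and, for every $t\in\mathbb{R}$, $$T_{\gamma_n,t}\rightharpoonup T_{\gamma,a_mt}\quad\text{in }\mathcal{D}'(\mathbb{R}^3,\mathbb{R}^3)\quad\text{as }n\to+\infty,$$ that is, $T_{\gamma_n,t}(X)\to T_{\gamma,a_mt}(X)$ for every $X\in\mathcal{D}(\mathbb{R}^3,\mathbb{R}^3)$. -/

import Mathlib

open scoped ContDiff Matrix InnerProductSpace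

noncomputable section

namespace BinormalFlow

/-- Euclidean three-space. -/
abbrev E3 : Type := EuclideanSpace ℝ (Fin 3)

/-- The vector product of `ℝ³`, on `EuclideanSpace ℝ (Fin 3)`. -/
def cross (x y : E3) : E3 := WithLp.toLp 2 (crossProduct x.ofLp y.ofLp)

/-- `γ : ℝ × (ℝ/ℓℤ) → ℝ³` is a smooth solution of the binormal curvature flow
`∂ₜγ = ∂ₛγ × ∂ₛₛγ` in arc-length parametrization. Functions on `ℝ/ℓℤ` are `ℓ`-periodic functions
on `ℝ`; the first argument of `γ` is the time, the second one the arc-length parameter. -/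
structure IsSmoothSolution (ℓ : ℝ) (γ : ℝ → ℝ → E3) : Prop where
  smooth : ContDiff ℝ ∞ (fun p : ℝ × ℝ => γ p.1 p.2)
  periodic : ∀ t, Function.Periodic (γ t) ℓ
  arclength : ∀ t s, ‖deriv (γ t) s‖ = 1
  flow : ∀ t s, deriv (fun τ => γ τ s) t = cross (deriv (γ t) s) (deriv (deriv (γ t)) s)

/-- The circle of center `c` and radius `r` in the plane through `c` perpendicular to `e`. -/
def circle (c e : E3) (r : ℝ) : Set E3 := {x | ⟪x - c, e⟫_ℝ = 0 ∧ ‖x - c‖ = r}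

/-- `γ` is a circle of radius `r` that travels at speed `1 / r` in the direction of a unit vector `e`
orthogonal to its plane: `γ(t,s) = γ(0,s) + (t / r) e`, where `γ(0,·)` parametrizes the circle. -/
def IsTravelingCircle (r : ℝ) (γ : ℝ → ℝ → E3) : Prop :=
  ∃ c e : E3, ‖e‖ = 1 ∧ Set.range (γ 0) = circle c e r ∧
    ∀ t s, γ t s = γ 0 s + (t / r) • e

/-- Smooth compactly supported vector fields on `ℝ³`. -/
abbrev TestField : Type := TestFunction (⊤ : TopologicalSpace.Opens E3) E3 ⊤

/-- The current `T_{γ,t}(X) = ∫₀^ℓ X(γ(t,s)) · ∂ₛγ(t,s) ds`. -/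
def current (ℓ : ℝ) (γ : ℝ → ℝ → E3) (t : ℝ) (X : TestField) : ℝ :=
  ∫ s in (0 : ℝ)..ℓ, ⟪X (γ t s), deriv (γ t) s⟫_ℝ

/-- Convergence in the sense of distributions: convergence against each test field. -/
def TendstoDistrib (T : ℕ → TestField → ℝ) (S : TestField → ℝ) : Prop :=
  ∀ X : TestField, Filter.Tendsto (fun n => T n X) Filter.atTop (nhds (S X))

/-- The factor `a_m = (3 / m - m) / 2`. -/
def slowFactor (m : ℝ) : ℝ := (1 / 2) * (3 / m - m)

end BinormalFlow

end

/-!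
In cylindrical coordinates about an axis, a curve which the binormal curvature flow moves by a
rotation about the axis and a translation along it is governed by its squared distance `u` to
the axis: the angle and the height are quadratures of `u`, and `u' ^ 2` is a cubic polynomial in
`u`. Letting `u` oscillate with a small amplitude `q` around a value close to `1` gives a thin
coil wound around the unit circle. Its height is periodic for the right choice of a constant,
and for arbitrarily small `q` the intermediate value theorem makes a whole number of coils fit
on one turn. The remaining parameter `v`, fixed as `q` tends to zero, tunes the pitch of the
coil, hence the limit `2 * π * m` of its length; the speed along the axis then tends to
`slowFactor m`. The rotation becomes infinitely fast, but it preserves the circle, so at every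
time the closed coils converge uniformly, up to reparametrization, to the circle in translation.
Uniform convergence with bounded lengths suffices for the convergence of the currents, by an
integration by parts.
-/

noncomputable section

namespace BinormalFlow

open Real Filter Topology
open scoped ComplexConjugate

section CrossProduct

theorem cross_add_left (x y z : E3) : cross (x + y) z = cross x z + cross y z := by
  simp [cross]

theorem cross_add_right (x y z : E3) : cross x (y + z) = cross x y + cross x z := by
  simp [cross]

theorem cross_smul_left (k : ℝ) (x y : E3) : cross (k • x) y = k • cross x y := by
  simp [cross]

theorem cross_smul_right (k : ℝ) (x y : E3) : cross x (k • y) = k • cross x y := by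
  simp [cross]

theorem cross_self_eq_zero (x : E3) : cross x x = 0 := by
  simp [cross]

theorem cross_swap (x y : E3) : cross y x = -cross x y :=
  (congrArg (WithLp.toLp 2) (cross_anticomm x.ofLp y.ofLp)).symm

theorem inner_eq_dotProduct (x y : E3) : ⟪x, y⟫_ℝ = x.ofLp ⬝ᵥ y.ofLp := by
  simp [EuclideanSpace.inner_eq_star_dotProduct, dotProduct_comm]

theorem inner_cross_self_left (x y : E3) : ⟪cross x y, x⟫_ℝ = 0 := by
  rw [real_inner_comm, inner_eq_dotProduct, cross, dot_self_cross]

theorem inner_cross_self_right (x y : E3) : ⟪cross x y, y⟫_ℝ = 0 := by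
  rw [real_inner_comm, inner_eq_dotProduct, cross, dot_cross_self]

theorem cross_cross_left (x y z : E3) :
    cross (cross x y) z = ⟪x, z⟫_ℝ • y - ⟪y, z⟫_ℝ • x := by
  simp only [inner_eq_dotProduct]
  exact congrArg (WithLp.toLp 2) (cross_cross_eq_smul_sub_smul x.ofLp y.ofLp z.ofLp)

theorem inner_cross_cross (x y : E3) :
    ⟪cross x y, cross x y⟫_ℝ = ⟪x, x⟫_ℝ * ⟪y, y⟫_ℝ - ⟪x, y⟫_ℝ * ⟪y, x⟫_ℝ := by
  simp only [inner_eq_dotProduct]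
  exact cross_dot_cross x.ofLp y.ofLp x.ofLp y.ofLp

end CrossProduct

section Frame

/-- Perpendicular unit vectors `f` and `e`, regarded as the first and the last vector of the
right-handed orthonormal frame `f, e × f, e`. -/
structure IsFrame (f e : E3) : Prop where
  norm_first : ‖f‖ = 1
  norm_last : ‖e‖ = 1
  inner_eq_zero : ⟪f, e⟫_ℝ = 0

/-- The vector with coordinates `w.re`, `w.im`, `h` in the frame `f, e × f, e`: the plane
perpendicular to `e` is identified with `ℂ`, so that a rotation about `e` becomes the multiplication
of `w` by a complex number of modulus one. -/
def frameMap (f e : E3) : ℂ × ℝ →L[ℝ] E3 :=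
  (Complex.reCLM ∘L .fst ℝ ℂ ℝ).smulRight f
    + (Complex.imCLM ∘L .fst ℝ ℂ ℝ).smulRight (cross e f) + (.snd ℝ ℂ ℝ : ℂ × ℝ →L[ℝ] ℝ).smulRight e

theorem frameMap_apply (f e : E3) (p : ℂ × ℝ) :
    frameMap f e p = p.1.re • f + p.1.im • cross e f + p.2 • e :=
  rfl

theorem hasDerivAt_frameMap (f e : E3) {w : ℝ → ℂ} {z : ℝ → ℝ} {w' : ℂ} {z' s : ℝ}
    (hw : HasDerivAt w w' s) (hz : HasDerivAt z z' s) :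
    HasDerivAt (fun s => frameMap f e (w s, z s)) (frameMap f e (w', z')) s :=
  (frameMap f e).hasFDerivAt.comp_hasDerivAt s (hw.prodMk hz)

variable {f e : E3}

theorem IsFrame.norm_frameMap_sq (hf : IsFrame f e) (p : ℂ × ℝ) :
    ‖frameMap f e p‖ ^ 2 = ‖p.1‖ ^ 2 + p.2 ^ 2 := by
  have hff : ⟪f, f⟫_ℝ = 1 := by rw [real_inner_self_eq_norm_sq, hf.norm_first, one_pow]
  have hee : ⟪e, e⟫_ℝ = 1 := by rw [real_inner_self_eq_norm_sq, hf.norm_last, one_pow]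
  have hef : ⟪e, f⟫_ℝ = 0 := by rw [real_inner_comm, hf.inner_eq_zero]
  rw [← real_inner_self_eq_norm_sq, frameMap_apply, Complex.sq_norm, Complex.normSq_apply]
  simp only [inner_add_left, inner_add_right, real_inner_smul_left, real_inner_smul_right,
    inner_cross_cross, inner_cross_self_left, inner_cross_self_right, hff, hee, hef,
    hf.inner_eq_zero, real_inner_comm (cross e f) f, real_inner_comm (cross e f) e]
  ring

theorem IsFrame.norm_frameMap_le (hf : IsFrame f e) (p : ℂ × ℝ) :
    ‖frameMap f e p‖ ≤ ‖p.1‖ + |p.2| := by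
  refine abs_le_of_sq_le_sq' ?_ (by positivity) |>.2
  rw [hf.norm_frameMap_sq, ← sq_abs p.2]
  nlinarith [mul_nonneg (norm_nonneg p.1) (abs_nonneg p.2)]

theorem IsFrame.cross_frameMap (hf : IsFrame f e) (p q : ℂ × ℝ) :
    cross (frameMap f e p) (frameMap f e q)
      = frameMap f e (Complex.I * (p.2 * q.1 - q.2 * p.1), (conj p.1 * q.1).im) := by
  have hgf : cross (cross e f) f = -e := by
    rw [cross_cross_left, real_inner_comm, hf.inner_eq_zero, real_inner_self_eq_norm_sq,
      hf.norm_first]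
    module
  have hge : cross (cross e f) e = f := by
    rw [cross_cross_left, hf.inner_eq_zero, real_inner_self_eq_norm_sq, hf.norm_last]
    module
  have hfg : cross f (cross e f) = e := by rw [cross_swap, hgf, neg_neg]
  have heg : cross e (cross e f) = -f := by rw [cross_swap, hge]
  simp only [frameMap_apply, cross_add_left, cross_add_right, cross_smul_left, cross_smul_right,
    cross_self_eq_zero, hgf, hge, hfg, heg, cross_swap e f]
  simp only [Complex.mul_re, Complex.mul_im, Complex.sub_re, Complex.sub_im, Complex.I_re,
    Complex.I_im, Complex.ofReal_re, Complex.ofReal_im, Complex.conj_re, Complex.conj_im]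
  module

end Frame

section Rescaling

variable {ℓ : ℝ} {γ : ℝ → ℝ → E3}

theorem IsSmoothSolution.contDiff_curve (h : IsSmoothSolution ℓ γ) (t : ℝ) :
    ContDiff ℝ ∞ (γ t) :=
  h.smooth.comp (contDiff_const.prodMk contDiff_id)

theorem IsSmoothSolution.contDiff_tangent (h : IsSmoothSolution ℓ γ) (t : ℝ) :
    ContDiff ℝ ∞ (deriv (γ t)) :=
  (contDiff_infty_iff_deriv.1 (h.contDiff_curve t)).2

/-- The image of a curve evolution under translation by `p` and the parabolic scaling by `r`. -/
def rescale (p : E3) (r : ℝ) (γ : ℝ → ℝ → E3) (t s : ℝ) : E3 :=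
  p + r • γ (r⁻¹ ^ 2 * t) (r⁻¹ * s)

theorem deriv_rescale (p : E3) {r : ℝ} (hr : r ≠ 0) (γ : ℝ → ℝ → E3) (t : ℝ) :
    deriv (rescale p r γ t) = fun s => deriv (γ (r⁻¹ ^ 2 * t)) (r⁻¹ * s) := by
  ext1 s
  unfold rescale
  rw [deriv_const_add, deriv_fun_const_smul_field, deriv_comp_mul_left, smul_inv_smul₀ hr]

theorem IsSmoothSolution.rescale (h : IsSmoothSolution ℓ γ) (p : E3) {r : ℝ} (hr : r ≠ 0) :
    IsSmoothSolution (r * ℓ) (rescale p r γ) where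
  smooth := contDiff_const.add <| (h.smooth.comp <|
    (contDiff_const.mul contDiff_fst).prodMk (contDiff_const.mul contDiff_snd)).const_smul r
  periodic t s := by
    simp only [BinormalFlow.rescale, mul_add, inv_mul_cancel_left₀ hr, h.periodic _ _]
  arclength t s := by rw [deriv_rescale p hr, h.arclength]
  flow t s := by
    rw [deriv_rescale p hr, deriv_comp_mul_left, cross_smul_right, ← h.flow]
    unfold BinormalFlow.rescale
    rw [deriv_const_add, deriv_fun_const_smul_field,
      deriv_comp_mul_left (r⁻¹ ^ 2) (fun τ => γ τ (r⁻¹ * s)), smul_smul]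
    congr 1
    field_simp

end Rescaling

section Circle

/-- The unit circle at height `h` around the axis of the frame `f, e × f, e`, parametrized by the
angle `β`. As a function of the time `h` and the arc length `β` it is the traveling unit circle. -/
def circleCurve (f e : E3) (h β : ℝ) : E3 := frameMap f e (Complex.exp (β * Complex.I), h)

theorem IsFrame.hasDerivAt_circleCurve {f e : E3} (hf : IsFrame f e) (h β : ℝ) :
    HasDerivAt (circleCurve f e h) (cross e (circleCurve f e h β)) β := by
  have haxis : frameMap f e (0, 1) = e := by simp [frameMap_apply]
  have hcross := hf.cross_frameMap (0, 1) (Complex.exp (β * Complex.I), h)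
  have hexp : HasDerivAt (fun β : ℝ => Complex.exp (β * Complex.I))
      (Complex.exp (β * Complex.I) * Complex.I) β := by
    simpa using (((hasDerivAt_id β).ofReal_comp).mul_const Complex.I).cexp
  refine (hasDerivAt_frameMap f e hexp (hasDerivAt_const β h)).congr_deriv ?_
  rw [haxis] at hcross
  rw [circleCurve, hcross]
  simp [mul_comm]

end Circle

section TravelingCircle

variable {ℓ r : ℝ} {γ : ℝ → ℝ → E3} {c e : E3}

theorem IsSmoothSolution.hasDerivAt_curve (h : IsSmoothSolution ℓ γ) (t s : ℝ) :
    HasDerivAt (γ t) (deriv (γ t) s) s :=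
  ((h.contDiff_curve t).differentiable (by simp) s).hasDerivAt

theorem IsSmoothSolution.hasDerivAt_tangent (h : IsSmoothSolution ℓ γ) (t s : ℝ) :
    HasDerivAt (deriv (γ t)) (deriv (deriv (γ t)) s) s :=
  ((h.contDiff_tangent t).differentiable (by simp) s).hasDerivAt

theorem IsSmoothSolution.inner_tangent_eq_zero (h : IsSmoothSolution ℓ γ) {t : ℝ}
    (hr : ∀ s, ‖γ t s - c‖ = r) (s : ℝ) : ⟪deriv (γ t) s, γ t s - c⟫_ℝ = 0 := by
  have hderiv := ((h.hasDerivAt_curve t s).sub_const c).norm_sq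
  simp only [hr] at hderiv
  have hzero := hderiv.unique (hasDerivAt_const s (r ^ 2))
  rw [real_inner_comm]
  linarith

theorem IsSmoothSolution.inner_deriv_tangent_eq_neg_one (h : IsSmoothSolution ℓ γ) {t : ℝ}
    (hr : ∀ s, ‖γ t s - c‖ = r) (s : ℝ) : ⟪deriv (deriv (γ t)) s, γ t s - c⟫_ℝ = -1 := by
  have hderiv := (h.hasDerivAt_tangent t s).inner ℝ ((h.hasDerivAt_curve t s).sub_const c)
  simp only [h.inner_tangent_eq_zero hr] at hderiv
  have hzero := hderiv.unique (hasDerivAt_const s 0)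
  rw [real_inner_self_eq_norm_sq, h.arclength] at hzero
  linarith

theorem IsSmoothSolution.tangent_eq_smul_cross (h : IsSmoothSolution ℓ γ)
    (hr : ∀ s, ‖γ 0 s - c‖ = r) (htravel : ∀ t s, γ t s = γ 0 s + (t / r) • e) (s : ℝ) :
    deriv (γ 0) s = r⁻¹ • cross e (γ 0 s - c) := by
  have hvelocity : HasDerivAt (fun τ => γ τ s) (r⁻¹ • e) 0 := by
    rw [funext fun τ => htravel τ s, ← one_div]
    exact (((hasDerivAt_id (0 : ℝ)).div_const r).smul_const e).const_add _
  rw [← cross_smul_left, ← hvelocity.deriv, h.flow, cross_cross_left, h.inner_tangent_eq_zero hr,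
    h.inner_deriv_tangent_eq_neg_one hr]
  module

theorem eq_of_hasDerivAt_smul_cross {k : ℝ} {x y : ℝ → E3}
    (hx : ∀ s, HasDerivAt x (k • cross e (x s)) s) (hy : ∀ s, HasDerivAt y (k • cross e (y s)) s)
    (h0 : x 0 = y 0) : x = y := by
  let field : E3 →ₗ[ℝ] E3 :=
    k • { toFun := cross e
          map_add' := cross_add_right e
          map_smul' := fun a => cross_smul_right a e }
  exact ODE_solution_unique_univ (v := fun _ => field) (s := fun _ => Set.univ)
    (fun _ => field.toContinuousLinearMap.lipschitz.lipschitzOnWith)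
    (fun s => ⟨hx s, Set.mem_univ _⟩) (fun s => ⟨hy s, Set.mem_univ _⟩) h0

theorem IsTravelingCircle.exists_eq_rescale (hcirc : IsTravelingCircle r γ)
    (h : IsSmoothSolution ℓ γ) (hr : 0 < r) :
    ∃ p f e, IsFrame f e ∧ γ = rescale p r (circleCurve f e) := by
  obtain ⟨c, e, he, hrange, htravel⟩ := hcirc
  have hmem : ∀ s, γ 0 s ∈ circle c e r := fun s => hrange ▸ Set.mem_range_self s
  set f := r⁻¹ • (γ 0 0 - c)
  have hf : IsFrame f e :=
    { norm_first := by
        rw [norm_smul, (hmem 0).2, norm_inv, norm_of_nonneg hr.le, inv_mul_cancel₀ hr.ne']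
      norm_last := he
      inner_eq_zero := by rw [real_inner_smul_left, (hmem 0).1, mul_zero] }
  have hγ : ∀ s, HasDerivAt (fun s => γ 0 s - c) (r⁻¹ • cross e (γ 0 s - c)) s := fun s =>
    h.tangent_eq_smul_cross (fun s => (hmem s).2) htravel s ▸ (h.hasDerivAt_curve 0 s).sub_const c
  have hcircle : ∀ s, HasDerivAt (fun s => r • circleCurve f e 0 (r⁻¹ * s))
      (r⁻¹ • cross e (r • circleCurve f e 0 (r⁻¹ * s))) s := fun s => by
    rw [cross_smul_right, smul_comm]
    exact ((hf.hasDerivAt_circleCurve 0 _).scomp s (hasDerivAt_const_mul r⁻¹)).const_smul r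
  have hstart : γ 0 0 - c = r • circleCurve f e 0 (r⁻¹ * 0) := by
    simp [circleCurve, frameMap_apply, f, hr.ne']
  refine ⟨c, f, e, hf, ?_⟩
  ext1 t
  ext1 s
  have hinitial := congrFun (eq_of_hasDerivAt_smul_cross hγ hcircle hstart) s
  have hlift : r * (r⁻¹ ^ 2 * t) = t / r := by field_simp
  rw [htravel, sub_eq_iff_eq_add'.1 hinitial, rescale]
  simp only [circleCurve, frameMap_apply, zero_smul, add_zero, smul_add, smul_smul, hlift,
    ← add_assoc]

end TravelingCircle

section RigidMotion

/-- A curve, with planar part `w` and height `z`, that moves by the binormal curvature flow as a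
rigid body: rotating about the axis with angular speed `Ω` and rising with speed `V`, while the
arc-length parameter slides along the curve with speed `C`. -/
structure IsRigidProfile (Ω V C : ℝ) (w : ℝ → ℂ) (z : ℝ → ℝ) : Prop where
  contDiff_planar : ContDiff ℝ ∞ w
  contDiff_height : ContDiff ℝ ∞ z
  norm_sq_deriv_add : ∀ s, ‖deriv w s‖ ^ 2 + deriv z s ^ 2 = 1
  deriv_deriv_planar : ∀ s,
    deriv (deriv w) s = Ω * deriv z s * w s + V * Complex.I * deriv w s
  deriv_deriv_height : ∀ s, deriv (deriv z) s = -Ω * (conj (w s) * deriv w s).re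
  slide : ∀ s, Ω * (conj (w s) * deriv w s).im + V * deriv z s = C

/-- The rigid motion of the curve with planar part `w` and height `z` in the frame `f, e × f, e`. -/
def rigidMotion (f e : E3) (Ω V C : ℝ) (w : ℝ → ℂ) (z : ℝ → ℝ) (t s : ℝ) : E3 :=
  frameMap f e (Complex.exp ((Ω * t : ℝ) * Complex.I) * w (s - C * t), z (s - C * t) + V * t)

variable {f e : E3} {Ω V C : ℝ} {w : ℝ → ℂ} {z : ℝ → ℝ}

namespace IsRigidProfile

theorem hasDerivAt_planar (h : IsRigidProfile Ω V C w z) (s : ℝ) :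
    HasDerivAt w (deriv w s) s :=
  (h.contDiff_planar.differentiable (by simp) s).hasDerivAt

theorem hasDerivAt_height (h : IsRigidProfile Ω V C w z) (s : ℝ) :
    HasDerivAt z (deriv z s) s :=
  (h.contDiff_height.differentiable (by simp) s).hasDerivAt

theorem hasDerivAt_deriv_planar (h : IsRigidProfile Ω V C w z) (s : ℝ) :
    HasDerivAt (deriv w) (deriv (deriv w) s) s :=
  ((contDiff_infty_iff_deriv.1 h.contDiff_planar).2.differentiable (by simp) s).hasDerivAt

theorem hasDerivAt_deriv_height (h : IsRigidProfile Ω V C w z) (s : ℝ) :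
    HasDerivAt (deriv z) (deriv (deriv z) s) s :=
  ((contDiff_infty_iff_deriv.1 h.contDiff_height).2.differentiable (by simp) s).hasDerivAt

theorem deriv_rigidMotion (h : IsRigidProfile Ω V C w z) (f e : E3) (t : ℝ) :
    deriv (rigidMotion f e Ω V C w z t) = fun s =>
      frameMap f e (Complex.exp ((Ω * t : ℝ) * Complex.I) * deriv w (s - C * t),
        deriv z (s - C * t)) := by
  ext1 s
  exact (hasDerivAt_frameMap f e
    (((h.hasDerivAt_planar _).comp_sub_const s (C * t)).const_mul _)
    (((h.hasDerivAt_height _).comp_sub_const s (C * t)).add_const _)).deriv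

theorem deriv_deriv_rigidMotion (h : IsRigidProfile Ω V C w z) (f e : E3) (t s : ℝ) :
    deriv (deriv (rigidMotion f e Ω V C w z t)) s =
      frameMap f e (Complex.exp ((Ω * t : ℝ) * Complex.I) * deriv (deriv w) (s - C * t),
        deriv (deriv z) (s - C * t)) := by
  rw [h.deriv_rigidMotion]
  exact (hasDerivAt_frameMap f e
    (((h.hasDerivAt_deriv_planar _).comp_sub_const s (C * t)).const_mul _)
    ((h.hasDerivAt_deriv_height _).comp_sub_const s (C * t))).deriv

theorem deriv_rigidMotion_time (h : IsRigidProfile Ω V C w z) (f e : E3) (t s : ℝ) :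
    deriv (fun τ => rigidMotion f e Ω V C w z τ s) t =
      frameMap f e (Complex.exp ((Ω * t : ℝ) * Complex.I)
        * (Ω * Complex.I * w (s - C * t) - C * deriv w (s - C * t)),
        V - C * deriv z (s - C * t)) := by
  have hrot : HasDerivAt (fun τ : ℝ => Complex.exp ((Ω * τ : ℝ) * Complex.I))
      (Complex.exp ((Ω * t : ℝ) * Complex.I) * (Ω * Complex.I)) t := by
    simpa using (((hasDerivAt_id t).const_mul Ω).ofReal_comp.mul_const Complex.I).cexp
  have harg : HasDerivAt (fun τ : ℝ => s - C * τ) (-C) t := by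
    simpa using ((hasDerivAt_id t).const_mul C).const_sub s
  have hw := hrot.mul ((h.hasDerivAt_planar (s - C * t)).scomp t harg)
  have hz := ((h.hasDerivAt_height (s - C * t)).comp t harg).add ((hasDerivAt_id t).const_mul V)
  refine (hasDerivAt_frameMap f e hw hz).deriv.trans ?_
  congr 2
  · simp only [Function.comp_apply, Complex.real_smul, Complex.ofReal_neg]
    ring
  · ring

/-- The key identity is `conj (conj w * w') * w' = ‖w'‖ ^ 2 * w`. -/
theorem planar_velocity (h : IsRigidProfile Ω V C w z) (s : ℝ) :
    Ω * Complex.I * w s - C * deriv w s =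
      Complex.I * (deriv z s * deriv (deriv w) s - deriv (deriv z) s * deriv w s) := by
  have hunit := h.norm_sq_deriv_add s
  rw [Complex.sq_norm, Complex.normSq_apply] at hunit
  rw [h.deriv_deriv_planar, h.deriv_deriv_height, ← h.slide s]
  apply Complex.ext <;>
    simp only [Complex.mul_im, Complex.mul_re, Complex.conj_re, Complex.conj_im, neg_mul,
      Complex.ofReal_add, Complex.ofReal_mul, Complex.ofReal_neg, Complex.sub_re, Complex.sub_im,
      Complex.ofReal_re, Complex.ofReal_im, Complex.I_re, Complex.I_im, mul_zero, mul_one, sub_self,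
      zero_mul, add_zero, zero_sub, Complex.add_re, Complex.add_im, sub_zero, Complex.neg_re,
      Complex.neg_im, neg_zero, sub_neg_eq_add, zero_add, one_mul]
  · linear_combination Ω * (w s).im * hunit
  · linear_combination -Ω * (w s).re * hunit

theorem height_velocity (h : IsRigidProfile Ω V C w z) (s : ℝ) :
    V - C * deriv z s = (conj (deriv w s) * deriv (deriv w) s).im := by
  have hunit := h.norm_sq_deriv_add s
  rw [Complex.sq_norm, Complex.normSq_apply] at hunit
  rw [h.deriv_deriv_planar, ← h.slide s]
  simp only [Complex.mul_im, Complex.conj_re, Complex.conj_im, neg_mul, Complex.add_im,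
    Complex.mul_re, Complex.ofReal_re, Complex.ofReal_im, mul_zero, sub_zero, zero_mul, add_zero,
    Complex.I_re, Complex.I_im, mul_one, sub_self, zero_add, Complex.add_re, zero_sub]
  linear_combination -V * hunit

theorem isSmoothSolution (h : IsRigidProfile Ω V C w z) (hf : IsFrame f e) {L : ℝ}
    (hw : Function.Periodic w L) (hz : Function.Periodic z L) :
    IsSmoothSolution L (rigidMotion f e Ω V C w z) where
  smooth := by
    have harg : ContDiff ℝ ∞ fun p : ℝ × ℝ => p.2 - C * p.1 := by fun_prop
    have hrot : ContDiff ℝ ∞ fun p : ℝ × ℝ => Complex.exp ((Ω * p.1 : ℝ) * Complex.I) :=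
      ((Complex.ofRealCLM.contDiff.comp (contDiff_const.mul contDiff_fst)).mul contDiff_const).cexp
    exact (frameMap f e).contDiff.comp <| (hrot.mul (h.contDiff_planar.comp harg)).prodMk <|
      (h.contDiff_height.comp harg).add (contDiff_const.mul contDiff_fst)
  periodic t s := by
    simp only [rigidMotion, add_sub_right_comm, hw _, hz _]
  arclength t s := by
    rw [h.deriv_rigidMotion, ← pow_eq_one_iff_of_nonneg (norm_nonneg _) two_ne_zero,
      hf.norm_frameMap_sq, norm_mul, Complex.norm_exp_ofReal_mul_I, one_mul, h.norm_sq_deriv_add]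
  flow t s := by
    have hrot : conj (Complex.exp ((Ω * t : ℝ) * Complex.I))
        * Complex.exp ((Ω * t : ℝ) * Complex.I) = 1 := by
      rw [mul_comm, Complex.mul_conj', Complex.norm_exp_ofReal_mul_I, Complex.ofReal_one, one_pow]
    rw [h.deriv_rigidMotion_time, h.deriv_deriv_rigidMotion, h.deriv_rigidMotion,
      hf.cross_frameMap, h.planar_velocity, h.height_velocity]
    congr 2
    · ring
    · rw [map_mul, mul_mul_mul_comm, hrot, one_mul]

end IsRigidProfile

end RigidMotion

section PeriodicODE

variable {E : Type*} [NormedAddCommGroup E] [NormedSpace ℝ E]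

theorem contDiff_of_hasDerivAt_comp {f : E → E} (hf : ContDiff ℝ ∞ f) {φ : ℝ → E}
    (hφ : ∀ s, HasDerivAt φ (f (φ s)) s) : ContDiff ℝ ∞ φ := by
  have hdiff : Differentiable ℝ φ := fun s => (hφ s).differentiableAt
  have hderiv : deriv φ = f ∘ φ := funext fun s => (hφ s).deriv
  refine contDiff_infty.2 fun n => ?_
  induction n with
  | zero => exact contDiff_zero.2 hdiff.continuous
  | succ n ih =>
    rw [Nat.cast_succ, contDiff_succ_iff_deriv, hderiv]
    exact ⟨hdiff, by simp, (contDiff_infty.1 hf n).comp ih⟩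

theorem contDiff_of_hasDerivAt_contDiff {y g : ℝ → E} (hg : ContDiff ℝ ∞ g)
    (hy : ∀ s, HasDerivAt y (g s) s) : ContDiff ℝ ∞ y := by
  rw [contDiff_infty_iff_deriv, show deriv y = g from funext fun s => (hy s).deriv]
  exact ⟨fun s => (hy s).differentiableAt, hg⟩

/-- The solution is the inverse of the primitive of `1 / f`. -/
theorem exists_solution_of_periodic_of_pos {f : ℝ → ℝ} (hf : Continuous f) (hpos : ∀ x, 0 < f x)
    {T : ℝ} (hT : 0 < T) (hper : Function.Periodic f T) :
    ∃ φ : ℝ → ℝ, φ 0 = 0 ∧ (∀ s, HasDerivAt φ (f (φ s)) s) ∧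
      ∀ s, φ (s + ∫ y in (0 : ℝ)..T, (f y)⁻¹) = φ s + T := by
  have hcont : Continuous fun y => (f y)⁻¹ := hf.inv₀ fun x => (hpos x).ne'
  have hinvpos : ∀ y, 0 < (f y)⁻¹ := fun y => inv_pos.2 (hpos y)
  have hinvper : Function.Periodic (fun y => (f y)⁻¹) T := hper.comp Inv.inv
  have hint : ∀ a b, IntervalIntegrable (fun y => (f y)⁻¹) MeasureTheory.volume a b :=
    hcont.intervalIntegrable
  set P : ℝ → ℝ := fun x => ∫ y in (0 : ℝ)..x, (f y)⁻¹
  have hPd : ∀ x, HasDerivAt P (f x)⁻¹ x := fun x =>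
    (hcont.integral_hasStrictDerivAt 0 x).hasDerivAt
  have hmono : StrictMono P := strictMono_of_hasDerivAt_pos hPd hinvpos
  have hsurj : Function.Surjective P :=
    (continuous_iff_continuousAt.2 fun x => (hPd x).continuousAt).surjective
      (hinvper.tendsto_atTop_intervalIntegral_of_pos' (hint 0 T) hinvpos hT)
      (hinvper.tendsto_atBot_intervalIntegral_of_pos' (hint 0 T) hinvpos hT)
  let e := (hmono.orderIsoOfSurjective P hsurj).toHomeomorph
  have he : ∀ x, P (e.symm x) = x := e.apply_symm_apply
  have hPadd : ∀ x, P (x + T) = P x + P T := fun x => by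
    simpa only [zero_add] using hinvper.intervalIntegral_add_eq_add 0 x hint
  refine ⟨e.symm, hmono.injective ?_, fun s => ?_, fun s => hmono.injective ?_⟩
  · exact (he 0).trans intervalIntegral.integral_same.symm
  · simpa only [inv_inv] using HasDerivAt.of_local_left_inverse (f := P)
      e.symm.continuous.continuousAt (hPd (e.symm s)) (hinvpos _).ne' (Eventually.of_forall he)
  · rw [he, hPadd, he]

theorem exists_quadrature {f φ : ℝ → ℝ} (hf : Continuous f) (hpos : ∀ x, 0 < f x)
    {h : ℝ → ℝ} (hh : Continuous h) {T s₀ : ℝ} (hfper : Function.Periodic f T)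
    (hhper : Function.Periodic h T) (hφ0 : φ 0 = 0) (hφ : ∀ s, HasDerivAt φ (f (φ s)) s)
    (hφT : ∀ s, φ (s + s₀) = φ s + T) :
    ∃ y : ℝ → ℝ, y 0 = 0 ∧ (∀ s, HasDerivAt y (h (φ s)) s) ∧
      ∀ s, y (s + s₀) = y s + ∫ x in (0 : ℝ)..T, h x / f x := by
  have hcont : Continuous fun x => h x / f x := hh.div hf fun x => (hpos x).ne'
  have hper : Function.Periodic (fun x => h x / f x) T := hhper.div hfper
  refine ⟨fun s => ∫ x in (0 : ℝ)..φ s, h x / f x, by simp [hφ0], fun s => ?_, fun s => ?_⟩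
  · refine ((hcont.integral_hasStrictDerivAt 0 (φ s)).hasDerivAt.comp s (hφ s)).congr_deriv ?_
    exact div_mul_cancel₀ _ (hpos _).ne'
  · simpa only [hφT, zero_add] using
      hper.intervalIntegral_add_eq_add 0 (φ s) hcont.intervalIntegrable

theorem norm_sub_linear_le_of_add_period {y : ℝ → E} (hy : Differentiable ℝ y) {B : ℝ}
    (hB : ∀ s, ‖deriv y s‖ ≤ B) {s₀ : ℝ} (hs₀ : 0 < s₀) {δ : E} (hδ : ∀ s, y (s + s₀) = y s + δ)
    (s : ℝ) : ‖y s - y 0 - (s / s₀) • δ‖ ≤ 2 * B * s₀ := by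
  have hlip : ∀ a b, ‖y b - y a‖ ≤ B * ‖b - a‖ := fun a b =>
    convex_univ.norm_image_sub_le_of_norm_deriv_le (fun x _ => hy x) (fun x _ => hB x)
      trivial trivial
  have hδB : ‖δ‖ ≤ B * s₀ := by
    have := hlip 0 (0 + s₀)
    rwa [hδ, add_sub_cancel_left, add_sub_cancel_left, norm_of_nonneg hs₀.le] at this
  have hper : Function.Periodic (fun s => y s - y 0 - (s / s₀) • δ) s₀ := fun s => by
    simp only [hδ, add_div, div_self hs₀.ne']
    module
  obtain ⟨a, ⟨ha0, ha⟩, has⟩ := hper.exists_mem_Ico₀ hs₀ s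
  have hB0 : 0 ≤ B := (norm_nonneg _).trans (hB 0)
  calc ‖y s - y 0 - (s / s₀) • δ‖ = ‖y a - y 0 - (a / s₀) • δ‖ := congrArg norm has
    _ ≤ B * ‖a - 0‖ + ‖(a / s₀) • δ‖ := (norm_sub_le _ _).trans (by gcongr; exact hlip 0 a)
    _ ≤ B * s₀ + 1 * (B * s₀) := by
        rw [sub_zero, norm_smul, norm_of_nonneg ha0, norm_of_nonneg (div_nonneg ha0 hs₀.le)]
        gcongr
        exact (div_le_one hs₀).2 ha.le
    _ = 2 * B * s₀ := by ring

end PeriodicODE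

section HelicalProfile

/-- The equations for a rigidly moving curve in cylindrical coordinates about its axis: `u` is the
squared distance to the axis, `θ` the polar angle and `z` the height. The constants `M` and `K` come
from integrating the equations for `θ` and `z` once. -/
structure IsHelicalProfile (Ω V K M : ℝ) (u θ z : ℝ → ℝ) : Prop where
  contDiff : ContDiff ℝ ∞ u
  pos : ∀ s, 0 < u s
  hasDerivAt_angle : ∀ s, HasDerivAt θ (V / 2 + M / u s) s
  hasDerivAt_height : ∀ s, HasDerivAt z (K - Ω * u s / 2) s
  energy : ∀ s, (deriv u s / 2) ^ 2 + (V * u s / 2 + M) ^ 2 = u s * (1 - (K - Ω * u s / 2) ^ 2)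
  acceleration : ∀ s, deriv (deriv u) s / 2 = 1 - (K - Ω * u s / 2) ^ 2
    + Ω * u s * (K - Ω * u s / 2) - V * (V * u s / 2 + M)

/-- The planar part of a curve given by its squared distance `u` to the axis and its polar
angle `θ`. -/
def planarPart (u θ : ℝ → ℝ) (s : ℝ) : ℂ :=
  √(u s) * Complex.exp (θ s * Complex.I)

/-- The logarithmic derivative of the planar part of a helical profile. It satisfies a Riccati
equation, which is the second order equation of `IsRigidProfile`. -/
def logDerivPlanar (V M : ℝ) (u : ℝ → ℝ) (s : ℝ) : ℂ :=
  (deriv u s / 2 + (V * u s / 2 + M) * Complex.I) / u s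

theorem normSq_planarPart {u : ℝ → ℝ} {s : ℝ} (hu : 0 ≤ u s) (θ : ℝ → ℝ) :
    Complex.normSq (planarPart u θ s) = u s := by
  rw [Complex.normSq_eq_norm_sq, planarPart, norm_mul, Complex.norm_exp_ofReal_mul_I, mul_one,
    Complex.norm_real, norm_of_nonneg (sqrt_nonneg _), sq_sqrt hu]

namespace IsHelicalProfile

variable {Ω V K M : ℝ} {u θ z : ℝ → ℝ}

theorem contDiff_angle (h : IsHelicalProfile Ω V K M u θ z) : ContDiff ℝ ∞ θ :=
  contDiff_of_hasDerivAt_contDiff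
    (contDiff_const.add (contDiff_const.div h.contDiff fun s => (h.pos s).ne')) h.hasDerivAt_angle

theorem contDiff_height (h : IsHelicalProfile Ω V K M u θ z) : ContDiff ℝ ∞ z :=
  contDiff_of_hasDerivAt_contDiff
    (contDiff_const.sub ((contDiff_const.mul h.contDiff).div_const 2)) h.hasDerivAt_height

theorem contDiff_planarPart (h : IsHelicalProfile Ω V K M u θ z) :
    ContDiff ℝ ∞ (planarPart u θ) :=
  (Complex.ofRealCLM.contDiff.comp (h.contDiff.sqrt fun s => (h.pos s).ne')).mul
    ((Complex.ofRealCLM.contDiff.comp h.contDiff_angle).mul contDiff_const).cexp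

theorem deriv_height (h : IsHelicalProfile Ω V K M u θ z) :
    deriv z = fun s => K - Ω * u s / 2 :=
  funext fun s => (h.hasDerivAt_height s).deriv

theorem hasDerivAt_sqDist (h : IsHelicalProfile Ω V K M u θ z) (s : ℝ) :
    HasDerivAt u (deriv u s) s :=
  (h.contDiff.differentiable (by simp) s).hasDerivAt

theorem hasDerivAt_deriv_sqDist (h : IsHelicalProfile Ω V K M u θ z) (s : ℝ) :
    HasDerivAt (deriv u) (deriv (deriv u) s) s :=
  ((contDiff_infty_iff_deriv.1 h.contDiff).2.differentiable (by simp) s).hasDerivAt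

theorem deriv_deriv_height (h : IsHelicalProfile Ω V K M u θ z) (s : ℝ) :
    deriv (deriv z) s = -Ω * (deriv u s / 2) := by
  rw [h.deriv_height, ((((h.hasDerivAt_sqDist s).const_mul Ω).div_const 2).const_sub K).deriv]
  ring

theorem hasDerivAt_planarPart (h : IsHelicalProfile Ω V K M u θ z) (s : ℝ) :
    HasDerivAt (planarPart u θ) (logDerivPlanar V M u s * planarPart u θ s) s := by
  have hradius := ((h.hasDerivAt_sqDist s).sqrt (h.pos s).ne').ofReal_comp
  have hangle := ((h.hasDerivAt_angle s).ofReal_comp.mul_const Complex.I).cexp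
  refine (hradius.mul hangle).congr_deriv ?_
  have hu : (u s : ℂ) ≠ 0 := Complex.ofReal_ne_zero.2 (h.pos s).ne'
  have hsqrt : (√(u s) : ℂ) ≠ 0 := Complex.ofReal_ne_zero.2 (sqrt_pos.2 (h.pos s)).ne'
  have hsq : (√(u s) : ℂ) ^ 2 = u s := by rw [← Complex.ofReal_pow, sq_sqrt (h.pos s).le]
  simp only [planarPart, logDerivPlanar, ← hsq]
  push_cast
  rw [← hsq]
  field_simp

theorem deriv_planarPart (h : IsHelicalProfile Ω V K M u θ z) :
    deriv (planarPart u θ) = fun s => logDerivPlanar V M u s * planarPart u θ s :=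
  funext fun s => (h.hasDerivAt_planarPart s).deriv

theorem conj_mul_deriv_planarPart (h : IsHelicalProfile Ω V K M u θ z) (s : ℝ) :
    conj (planarPart u θ s) * deriv (planarPart u θ) s
      = ⟨deriv u s / 2, V * u s / 2 + M⟩ := by
  have hu : (u s : ℂ) ≠ 0 := Complex.ofReal_ne_zero.2 (h.pos s).ne'
  rw [h.deriv_planarPart, mul_left_comm, ← Complex.normSq_eq_conj_mul_self,
    normSq_planarPart (h.pos s).le, logDerivPlanar, div_mul_cancel₀ _ hu,
    Complex.mk_eq_add_mul_I]
  push_cast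
  rfl

theorem hasDerivAt_logDerivPlanar (h : IsHelicalProfile Ω V K M u θ z) (s : ℝ) :
    HasDerivAt (logDerivPlanar V M u)
      (Ω * deriv z s + V * Complex.I * logDerivPlanar V M u s - logDerivPlanar V M u s ^ 2) s := by
  have hu := (h.hasDerivAt_sqDist s).ofReal_comp
  have hne : (u s : ℂ) ≠ 0 := Complex.ofReal_ne_zero.2 (h.pos s).ne'
  have hnum := ((h.hasDerivAt_deriv_sqDist s).ofReal_comp.div_const 2).add
    ((((hu.const_mul (V : ℂ)).div_const 2).add_const (M : ℂ)).mul_const Complex.I)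
  refine (hnum.div hu hne).congr_deriv ?_
  have henergy := congrArg ((↑) : ℝ → ℂ) (h.energy s)
  have hacc := congrArg ((↑) : ℝ → ℂ) (h.acceleration s)
  push_cast at henergy hacc
  simp only [h.deriv_height, logDerivPlanar, Pi.add_apply, hacc]
  push_cast
  field_simp
  linear_combination -4 * henergy + (4 * (M : ℂ) ^ 2 - u s ^ 2 * V ^ 2) * Complex.I_sq

theorem isRigidProfile (h : IsHelicalProfile Ω V K M u θ z) :
    IsRigidProfile Ω V (Ω * M + V * K) (planarPart u θ) z where
  contDiff_planar := h.contDiff_planarPart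
  contDiff_height := h.contDiff_height
  norm_sq_deriv_add s := by
    have hu := h.pos s
    have hprod := congrArg Complex.normSq (h.conj_mul_deriv_planarPart s)
    rw [Complex.normSq_mul, Complex.normSq_conj, normSq_planarPart hu.le,
      Complex.normSq_mk (deriv u s / 2), ← sq, ← sq, h.energy s, mul_right_inj' hu.ne',
      Complex.normSq_eq_norm_sq] at hprod
    rw [hprod, h.deriv_height]
    ring
  deriv_deriv_planar s := by
    rw [h.deriv_planarPart,
      ((h.hasDerivAt_logDerivPlanar s).fun_mul (h.hasDerivAt_planarPart s)).deriv]
    ring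
  deriv_deriv_height s := by
    rw [h.deriv_deriv_height, h.conj_mul_deriv_planarPart]
  slide s := by
    rw [h.conj_mul_deriv_planarPart, h.deriv_height]
    ring

end IsHelicalProfile

end HelicalProfile

section Parameters

/-- The function `√(1 + q cos x)` for `0 ≤ q ≤ 1 / 2`, truncated from below in order to be positive
and continuous for all `q`. -/
def phaseSpeed (q x : ℝ) : ℝ := √(max (1 + q * cos x) (1 / 2))

/-- The time in which a solution of `φ' = phaseSpeed q φ` advances by `2π`. -/
def phasePeriod (q : ℝ) : ℝ := ∫ x in (0 : ℝ)..(2 * π), (phaseSpeed q x)⁻¹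

/-- The integral of `cos / phaseSpeed q` over a period, divided by `-q`, in a form that is regular
at `q = 0`. -/
def cosMoment (q : ℝ) : ℝ :=
  ∫ x in (0 : ℝ)..(2 * π), cos x ^ 2 / (phaseSpeed q x * (1 + phaseSpeed q x))

/-- The time average of `cos φ` along a solution of `φ' = phaseSpeed q φ`, divided by `-q`. -/
def drift (q : ℝ) : ℝ := cosMoment q / phasePeriod q

/-- The squared distance to the axis is confined by the roots of a cubic; this is the third root,
divided by `-q ^ 2`. -/
def thirdRoot (v q : ℝ) : ℝ := v ^ 2 + 2 * drift q

/-- The squared distance to the axis oscillates between `midSqDist v q - q` and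
`midSqDist v q + q`. -/
def midSqDist (v q : ℝ) : ℝ := 1 - q ^ 2 * thirdRoot v q

/-- The constant `M` of the helical profile, divided by `q * Ω`. -/
def angMom (v q : ℝ) : ℝ := √((midSqDist v q ^ 2 - q ^ 2) * thirdRoot v q) / 2

/-- The square of `1 / (q * Ω)` for the angular speed `Ω` at which the profile, so far determined up
to the scale of its parameter, is parametrized by arc-length. -/
def arcScaleSq (v q : ℝ) : ℝ :=
  q ^ 2 * drift q ^ 2 / 4 + midSqDist v q * (v ^ 2 + drift q) / 2 + v * angMom v q + 1 / 4

/-- The angle swept by the helical profile over a period of the phase, divided by `q`. -/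
def sweptAngle (v q : ℝ) : ℝ :=
  ∫ x in (0 : ℝ)..(2 * π),
    (v / 2 + angMom v q / max (midSqDist v q + q * cos x) (1 / 2)) / phaseSpeed q x

variable {q : ℝ}

theorem phaseSpeed_pos (q x : ℝ) : 0 < phaseSpeed q x := by
  unfold phaseSpeed
  positivity

theorem continuous_phaseSpeed_prod : Continuous fun p : ℝ × ℝ => phaseSpeed p.1 p.2 := by
  unfold phaseSpeed
  fun_prop

theorem continuous_phaseSpeed (q : ℝ) : Continuous (phaseSpeed q) :=
  continuous_phaseSpeed_prod.comp (.prodMk_right q)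

theorem periodic_phaseSpeed (q : ℝ) : Function.Periodic (phaseSpeed q) (2 * π) := fun x => by
  simp only [phaseSpeed, cos_add_two_pi]

theorem phaseSpeed_zero (x : ℝ) : phaseSpeed 0 x = 1 := by
  norm_num [phaseSpeed]

theorem half_le_one_add_mul_cos (h0 : 0 ≤ q) (h1 : q ≤ 1 / 2) (x : ℝ) :
    1 / 2 ≤ 1 + q * cos x := by
  nlinarith [neg_one_le_cos x]

theorem phaseSpeed_sq (h0 : 0 ≤ q) (h1 : q ≤ 1 / 2) (x : ℝ) :
    phaseSpeed q x ^ 2 = 1 + q * cos x := by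
  rw [phaseSpeed, sq_sqrt (by positivity), max_eq_left (half_le_one_add_mul_cos h0 h1 x)]

theorem phaseSpeed_eq (h0 : 0 ≤ q) (h1 : q ≤ 1 / 2) :
    phaseSpeed q = fun x => √(1 + q * cos x) :=
  funext fun x => by rw [phaseSpeed, max_eq_left (half_le_one_add_mul_cos h0 h1 x)]

theorem contDiff_phaseSpeed (h0 : 0 ≤ q) (h1 : q ≤ 1 / 2) : ContDiff ℝ ∞ (phaseSpeed q) := by
  rw [phaseSpeed_eq h0 h1]
  refine ContDiff.sqrt (by fun_prop) fun x => ?_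
  linarith [half_le_one_add_mul_cos h0 h1 x]

theorem hasDerivAt_phaseSpeed (h0 : 0 ≤ q) (h1 : q ≤ 1 / 2) (x : ℝ) :
    HasDerivAt (phaseSpeed q) (-(q * sin x) / (2 * phaseSpeed q x)) x := by
  have harg : HasDerivAt (fun x => 1 + q * cos x) (-(q * sin x)) x := by
    simpa using ((hasDerivAt_cos x).const_mul q).const_add 1
  rw [phaseSpeed_eq h0 h1]
  exact harg.sqrt (by linarith [half_le_one_add_mul_cos h0 h1 x])

theorem phasePeriod_pos (q : ℝ) : 0 < phasePeriod q :=
  intervalIntegral.intervalIntegral_pos_of_pos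
    (((continuous_phaseSpeed q).inv₀ fun x => (phaseSpeed_pos q x).ne').intervalIntegrable _ _)
    (fun x => inv_pos.2 (phaseSpeed_pos q x)) two_pi_pos

theorem integral_cos_div_phaseSpeed (h0 : 0 ≤ q) (h1 : q ≤ 1 / 2) :
    ∫ x in (0 : ℝ)..(2 * π), cos x / phaseSpeed q x = -(q * cosMoment q) := by
  have hcont := continuous_phaseSpeed q
  have hexpand : ∀ x, cos x / phaseSpeed q x
      = cos x - q * (cos x ^ 2 / (phaseSpeed q x * (1 + phaseSpeed q x))) := fun x => by
    have hpos := phaseSpeed_pos q x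
    field_simp
    linear_combination (-cos x) * phaseSpeed_sq h0 h1 x
  simp_rw [hexpand]
  rw [intervalIntegral.integral_sub (continuous_cos.intervalIntegrable _ _),
    intervalIntegral.integral_const_mul, integral_cos, sin_two_pi, sin_zero, sub_zero, zero_sub,
    cosMoment]
  refine Continuous.intervalIntegrable (continuous_const.mul (.div (by fun_prop) (by fun_prop)
    fun x => ?_)) _ _
  have hpos := phaseSpeed_pos q x
  positivity

theorem cosMoment_eq_drift_mul (q : ℝ) : cosMoment q = drift q * phasePeriod q :=
  (div_mul_cancel₀ _ (phasePeriod_pos q).ne').symm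

theorem cosMoment_nonneg (q : ℝ) : 0 ≤ cosMoment q := by
  refine intervalIntegral.integral_nonneg two_pi_pos.le fun x _ => ?_
  have hpos := phaseSpeed_pos q x
  positivity

theorem thirdRoot_nonneg (v q : ℝ) : 0 ≤ thirdRoot v q := by
  have hdrift : 0 ≤ drift q := div_nonneg (cosMoment_nonneg q) (phasePeriod_pos q).le
  unfold thirdRoot
  positivity

/-- The range of parameters in which `v` and `q` determine a helical profile. -/
structure IsAdmissible (v q : ℝ) : Prop where
  pos : 0 < q
  le_half : q ≤ 1 / 2
  half_le : 1 / 2 ≤ midSqDist v q - q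
  arcScaleSq_pos : 0 < arcScaleSq v q

/-- The angular speed `Ω` of the profile with parameters `v` and `q`. -/
def rotSpeed (v q : ℝ) : ℝ := 1 / (q * √(arcScaleSq v q))

/-- The speed `V` along the axis of the profile with parameters `v` and `q`. -/
def riseSpeed (v q : ℝ) : ℝ := v / √(arcScaleSq v q)

/-- The constant `K` of the profile with parameters `v` and `q`, for which the height is
periodic. -/
def heightConst (v q : ℝ) : ℝ := rotSpeed v q * (midSqDist v q / 2 - q ^ 2 * drift q / 2)

/-- The constant `M` of the profile with parameters `v` and `q`. -/
def angleConst (v q : ℝ) : ℝ := rotSpeed v q * q * angMom v q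

namespace IsAdmissible

variable {v : ℝ}

theorem rotSpeed_pos (h : IsAdmissible v q) : 0 < rotSpeed v q :=
  one_div_pos.2 (mul_pos h.pos (sqrt_pos.2 h.arcScaleSq_pos))

theorem rotSpeed_sq (h : IsAdmissible v q) : rotSpeed v q ^ 2 * q ^ 2 * arcScaleSq v q = 1 := by
  have hq := h.pos
  have hpos := h.arcScaleSq_pos
  rw [rotSpeed, div_pow, mul_pow, sq_sqrt hpos.le]
  field_simp

theorem riseSpeed_eq (h : IsAdmissible v q) : riseSpeed v q = rotSpeed v q * q * v := by
  have hq := h.pos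
  rw [riseSpeed, rotSpeed]
  field_simp

theorem angMom_sq (h : IsAdmissible v q) :
    angMom v q ^ 2 = (midSqDist v q ^ 2 - q ^ 2) * thirdRoot v q / 4 := by
  have hprod : 0 ≤ (midSqDist v q ^ 2 - q ^ 2) * thirdRoot v q :=
    mul_nonneg (by nlinarith [h.pos, h.half_le]) (thirdRoot_nonneg v q)
  rw [angMom, div_pow, sq_sqrt hprod]
  norm_num

theorem half_le_sqDist (h : IsAdmissible v q) (x : ℝ) : 1 / 2 ≤ midSqDist v q + q * cos x := by
  nlinarith [neg_one_le_cos x, h.pos, h.half_le]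

/-- In the variable `x = u - midSqDist v q`, the cubic of the energy equation has the roots `q`,
`-q` and `-1`. -/
theorem cubic_energy (h : IsAdmissible v q) (x : ℝ) :
    rotSpeed v q ^ 2 * (1 + x) * (q ^ 2 - x ^ 2) / 4
        + (riseSpeed v q * (midSqDist v q + x) / 2 + angleConst v q) ^ 2
      = (midSqDist v q + x)
        * (1 - (heightConst v q - rotSpeed v q * (midSqDist v q + x) / 2) ^ 2) := by
  have hscale := h.rotSpeed_sq
  have hmom := h.angMom_sq
  have hmid : midSqDist v q = 1 - q ^ 2 * (v ^ 2 + 2 * drift q) := rfl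
  rw [arcScaleSq] at hscale
  rw [thirdRoot] at hmom
  rw [h.riseSpeed_eq, heightConst, angleConst]
  linear_combination (midSqDist v q + x) * hscale + rotSpeed v q ^ 2 * q ^ 2 * hmom
    - (q ^ 2 - x ^ 2) * rotSpeed v q ^ 2 / 4 * hmid

/-- The derivative of `cubic_energy` with respect to `x`. -/
theorem cubic_acceleration (h : IsAdmissible v q) (x : ℝ) :
    rotSpeed v q ^ 2 * (q ^ 2 - 2 * x - 3 * x ^ 2) / 4
      = 1 - (heightConst v q - rotSpeed v q * (midSqDist v q + x) / 2) ^ 2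
        + rotSpeed v q * (midSqDist v q + x)
          * (heightConst v q - rotSpeed v q * (midSqDist v q + x) / 2)
        - riseSpeed v q * (riseSpeed v q * (midSqDist v q + x) / 2 + angleConst v q) := by
  have hscale := h.rotSpeed_sq
  have hmid : midSqDist v q = 1 - q ^ 2 * (v ^ 2 + 2 * drift q) := rfl
  rw [arcScaleSq] at hscale
  rw [h.riseSpeed_eq, heightConst, angleConst]
  linear_combination hscale + rotSpeed v q ^ 2 * x / 2 * hmid

end IsAdmissible

end Parameters

section ProfileExistence

/-- A shift of the parameter by `s₀` rotates the curve with squared distance `u` to the axis, polar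
angle `θ` and height `z` by the angle `δ` about the axis; the angle and the height start at zero. -/
structure IsTurnPeriodic (s₀ δ : ℝ) (u θ z : ℝ → ℝ) : Prop where
  periodic : Function.Periodic u s₀
  angle_add : ∀ s, θ (s + s₀) = θ s + δ
  periodic_height : Function.Periodic z s₀
  angle_zero : θ 0 = 0
  height_zero : z 0 = 0

/-- The squared distance to the axis as a function of the phase `φ`. -/
def sqDist (v q : ℝ) (φ : ℝ → ℝ) (s : ℝ) : ℝ := midSqDist v q + q * cos (φ s)

variable {v q : ℝ} {φ : ℝ → ℝ}

theorem deriv_sqDist (hφ : ∀ s, HasDerivAt φ (rotSpeed v q * phaseSpeed q (φ s)) s) :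
    deriv (sqDist v q φ) =
      fun s => q * (-sin (φ s) * (rotSpeed v q * phaseSpeed q (φ s))) :=
  funext fun s => (((hφ s).cos.const_mul q).const_add _).deriv

theorem integral_inv_rotSpeed_mul_phaseSpeed :
    ∫ x in (0 : ℝ)..(2 * π), (rotSpeed v q * phaseSpeed q x)⁻¹
      = q * √(arcScaleSq v q) * phasePeriod q := by
  simp only [mul_inv, intervalIntegral.integral_const_mul, rotSpeed, one_div, inv_inv, phasePeriod]

namespace IsAdmissible

theorem hasDerivAt_phaseVelocity (h : IsAdmissible v q)
    (hφ : ∀ s, HasDerivAt φ (rotSpeed v q * phaseSpeed q (φ s)) s) (s : ℝ) :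
    HasDerivAt (fun s => rotSpeed v q * phaseSpeed q (φ s))
      (-(rotSpeed v q ^ 2 * q * sin (φ s)) / 2) s := by
  have hpos := phaseSpeed_pos q (φ s)
  refine (((hasDerivAt_phaseSpeed h.pos.le h.le_half (φ s)).comp s (hφ s)).const_mul
    (rotSpeed v q)).congr_deriv ?_
  field_simp

theorem deriv_deriv_sqDist (h : IsAdmissible v q)
    (hφ : ∀ s, HasDerivAt φ (rotSpeed v q * phaseSpeed q (φ s)) s) (s : ℝ) :
    deriv (deriv (sqDist v q φ)) s = rotSpeed v q ^ 2
      * (q ^ 2 - 2 * (q * cos (φ s)) - 3 * (q * cos (φ s)) ^ 2) / 2 := by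
  rw [deriv_sqDist hφ,
    (((hφ s).sin.fun_neg.fun_mul (h.hasDerivAt_phaseVelocity hφ s)).const_mul q).deriv]
  linear_combination -q * cos (φ s) * rotSpeed v q ^ 2 * phaseSpeed_sq h.pos.le h.le_half (φ s)
    + q ^ 2 * rotSpeed v q ^ 2 / 2 * sin_sq_add_cos_sq (φ s)

theorem isHelicalProfile (h : IsAdmissible v q)
    (hφ : ∀ s, HasDerivAt φ (rotSpeed v q * phaseSpeed q (φ s)) s) {θ z : ℝ → ℝ}
    (hθ : ∀ s, HasDerivAt θ (riseSpeed v q / 2 + angleConst v q / sqDist v q φ s) s)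
    (hz : ∀ s, HasDerivAt z (heightConst v q - rotSpeed v q * sqDist v q φ s / 2) s) :
    IsHelicalProfile (rotSpeed v q) (riseSpeed v q) (heightConst v q) (angleConst v q)
      (sqDist v q φ) θ z where
  contDiff := contDiff_const.add <| contDiff_const.mul <| contDiff_cos.comp <|
    contDiff_of_hasDerivAt_comp
      (contDiff_const.mul (contDiff_phaseSpeed h.pos.le h.le_half)) hφ
  pos s := one_half_pos.trans_le (h.half_le_sqDist (φ s))
  hasDerivAt_angle := hθ
  hasDerivAt_height := hz
  energy s := by
    rw [deriv_sqDist hφ]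
    refine Eq.trans ?_ (h.cubic_energy (q * cos (φ s)))
    simp only [sqDist]
    linear_combination
      q ^ 2 * rotSpeed v q ^ 2 * sin (φ s) ^ 2 / 4 * phaseSpeed_sq h.pos.le h.le_half (φ s)
      + q ^ 2 * rotSpeed v q ^ 2 * (1 + q * cos (φ s)) / 4 * sin_sq_add_cos_sq (φ s)
  acceleration s := by
    rw [h.deriv_deriv_sqDist hφ]
    refine Eq.trans ?_ (h.cubic_acceleration (q * cos (φ s)))
    ring

theorem integral_angle_eq_mul_sweptAngle (h : IsAdmissible v q) :
    ∫ x in (0 : ℝ)..(2 * π), (riseSpeed v q / 2 + angleConst v q / (midSqDist v q + q * cos x))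
      / (rotSpeed v q * phaseSpeed q x) = q * sweptAngle v q := by
  rw [sweptAngle, ← intervalIntegral.integral_const_mul]
  congr 1
  ext1 x
  have hspeed := phaseSpeed_pos q x
  have hrot := h.rotSpeed_pos
  have hu : midSqDist v q + q * cos x ≠ 0 := by linarith [h.half_le_sqDist x]
  rw [max_eq_left (h.half_le_sqDist x), h.riseSpeed_eq, angleConst]
  field_simp

theorem integral_height_eq_zero (h : IsAdmissible v q) :
    ∫ x in (0 : ℝ)..(2 * π), (heightConst v q - rotSpeed v q * (midSqDist v q + q * cos x) / 2)
      / (rotSpeed v q * phaseSpeed q x) = 0 := by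
  have hcont := continuous_phaseSpeed q
  have hne : ∀ x, phaseSpeed q x ≠ 0 := fun x => (phaseSpeed_pos q x).ne'
  have hinv : IntervalIntegrable (fun x => (phaseSpeed q x)⁻¹) MeasureTheory.volume 0 (2 * π) :=
    (hcont.inv₀ hne).intervalIntegrable _ _
  have hcos : IntervalIntegrable (fun x => cos x / phaseSpeed q x) MeasureTheory.volume 0 (2 * π) :=
    (continuous_cos.div hcont hne).intervalIntegrable _ _
  have hsplit : ∀ x, (heightConst v q - rotSpeed v q * (midSqDist v q + q * cos x) / 2)
      / (rotSpeed v q * phaseSpeed q x)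
        = -(q ^ 2 * drift q / 2) * (phaseSpeed q x)⁻¹ - q / 2 * (cos x / phaseSpeed q x) :=
    fun x => by
      have hrot := h.rotSpeed_pos
      have hspeed := phaseSpeed_pos q x
      rw [heightConst]
      field_simp
      ring
  simp_rw [hsplit]
  rw [intervalIntegral.integral_sub (hinv.const_mul _) (hcos.const_mul _),
    intervalIntegral.integral_const_mul, intervalIntegral.integral_const_mul,
    integral_cos_div_phaseSpeed h.pos.le h.le_half, cosMoment_eq_drift_mul, ← phasePeriod]
  ring

theorem exists_isHelicalProfile (h : IsAdmissible v q) :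
    ∃ u θ z, IsHelicalProfile (rotSpeed v q) (riseSpeed v q) (heightConst v q) (angleConst v q)
        u θ z ∧
      IsTurnPeriodic (q * √(arcScaleSq v q) * phasePeriod q) (q * sweptAngle v q) u θ z ∧
      ∀ s, |u s - midSqDist v q| ≤ q := by
  have hcont : Continuous fun x => rotSpeed v q * phaseSpeed q x :=
    continuous_const.mul (continuous_phaseSpeed q)
  have hpos : ∀ x, 0 < rotSpeed v q * phaseSpeed q x :=
    fun x => mul_pos h.rotSpeed_pos (phaseSpeed_pos q x)
  have hper : Function.Periodic (fun x => rotSpeed v q * phaseSpeed q x) (2 * π) :=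
    (periodic_phaseSpeed q).comp _
  have hune : ∀ x, midSqDist v q + q * cos x ≠ 0 := fun x => by linarith [h.half_le_sqDist x]
  obtain ⟨φ, hφ0, hφ, hφadd⟩ := exists_solution_of_periodic_of_pos hcont hpos two_pi_pos hper
  rw [integral_inv_rotSpeed_mul_phaseSpeed] at hφadd
  obtain ⟨θ, hθ0, hθ, hθadd⟩ := exists_quadrature hcont hpos
    (h := fun x => riseSpeed v q / 2 + angleConst v q / (midSqDist v q + q * cos x))
    (by fun_prop (disch := exact hune _)) hper (fun x => by simp only [cos_add_two_pi]) hφ0 hφ hφadd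
  obtain ⟨z, hz0, hz, hzadd⟩ := exists_quadrature hcont hpos
    (h := fun x => heightConst v q - rotSpeed v q * (midSqDist v q + q * cos x) / 2)
    (by fun_prop) hper (fun x => by simp only [cos_add_two_pi]) hφ0 hφ hφadd
  rw [h.integral_angle_eq_mul_sweptAngle] at hθadd
  simp only [h.integral_height_eq_zero, add_zero] at hzadd
  refine ⟨sqDist v q φ, θ, z, h.isHelicalProfile hφ hθ hz, ⟨fun s => ?_, hθadd, hzadd, hθ0, hz0⟩,
    fun s => ?_⟩
  · simp only [sqDist, hφadd, cos_add_two_pi]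
  · rw [sqDist, add_sub_cancel_left, abs_mul, abs_of_pos h.pos]
    exact mul_le_of_le_one_right h.pos.le (abs_cos_le_one _)

end IsAdmissible

end ProfileExistence

section ClosingUp

theorem IsTurnPeriodic.periodic_planarPart {s₀ δ : ℝ} {u θ z : ℝ → ℝ} {n : ℕ}
    (h : IsTurnPeriodic s₀ δ u θ z) (hn : n * δ = 2 * π) :
    Function.Periodic (planarPart u θ) (n * s₀) := fun s => by
  have hu : u (s + n * s₀) = u s := h.periodic.nat_mul n s
  have hθ : θ (s + n * s₀) = θ s + 2 * π := by
    rw [← hn, ← nsmul_eq_mul, ← nsmul_eq_mul]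
    exact AddConstMapClass.map_add_nsmul (⟨θ, h.angle_add⟩ : AddConstMap ℝ ℝ s₀ δ) s n
  rw [planarPart, hu, hθ, Complex.ofReal_add, add_mul, Complex.exp_add, Complex.ofReal_mul,
    Complex.ofReal_ofNat, Complex.exp_two_pi_mul_I, mul_one, planarPart]

namespace IsHelicalProfile

variable {Ω V K M : ℝ} {u θ z : ℝ → ℝ}

theorem abs_deriv_height_le (h : IsHelicalProfile Ω V K M u θ z) (s : ℝ) : |deriv z s| ≤ 1 := by
  have hu := h.pos s
  have hnonneg : 0 ≤ u s * (1 - (K - Ω * u s / 2) ^ 2) := by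
    rw [← h.energy s]
    positivity
  rw [h.deriv_height, ← sq_le_one_iff_abs_le_one]
  linarith [nonneg_of_mul_nonneg_right hnonneg hu]

theorem abs_deriv_angle_le (h : IsHelicalProfile Ω V K M u θ z) {s : ℝ} (hu : 1 / 4 ≤ u s) :
    |deriv θ s| ≤ 2 := by
  have hpos := h.pos s
  have hmom : u s * deriv θ s = V * u s / 2 + M := by
    rw [(h.hasDerivAt_angle s).deriv]
    field_simp
  have hle : (u s * deriv θ s) ^ 2 ≤ u s := by
    rw [hmom]
    nlinarith [h.energy s, sq_nonneg (deriv u s / 2), sq_nonneg (K - Ω * u s / 2)]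
  refine abs_le_of_sq_le_sq ?_ two_pos.le
  have hmul : u s * deriv θ s ^ 2 ≤ 1 :=
    le_of_mul_le_mul_left (by linarith [mul_pow (u s) (deriv θ s) 2]) hpos
  nlinarith [sq_nonneg (deriv θ s)]

end IsHelicalProfile

theorem norm_sqrt_mul_exp_sub_exp_le {a : ℝ} (ha : 0 ≤ a) (x y : ℝ) :
    ‖(√a : ℂ) * Complex.exp (x * Complex.I) - Complex.exp (y * Complex.I)‖ ≤ |a - 1| + |x - y| := by
  have hsplit : (√a : ℂ) * Complex.exp (x * Complex.I) - Complex.exp (y * Complex.I)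
      = (√a - 1 : ℝ) * Complex.exp (x * Complex.I)
        + Complex.exp (y * Complex.I) * (Complex.exp (Complex.I * (x - y : ℝ)) - 1) := by
    rw [mul_sub, ← Complex.exp_add]
    push_cast
    ring_nf
  have hradius : |√a - 1| ≤ |a - 1| := by
    have hfactor : a - 1 = (√a - 1) * (√a + 1) := by linear_combination -sq_sqrt ha
    rw [hfactor, abs_mul]
    refine le_mul_of_one_le_right (abs_nonneg _) ((le_abs_self _).trans' ?_)
    linarith [sqrt_nonneg a]
  rw [hsplit]
  refine (norm_add_le _ _).trans (add_le_add ?_ ?_)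
  · rwa [norm_mul, Complex.norm_exp_ofReal_mul_I, mul_one, Complex.norm_real]
  · rw [norm_mul, Complex.norm_exp_ofReal_mul_I, one_mul]
    exact norm_exp_I_mul_ofReal_sub_one_le

theorem norm_rigidMotion_sub_circleCurve_le {f e : E3} (hf : IsFrame f e) {Ω V K M : ℝ}
    {u θ z : ℝ → ℝ} (h : IsHelicalProfile Ω V K M u θ z) {s₀ δ : ℝ} (hs₀ : 0 < s₀)
    (hturn : IsTurnPeriodic s₀ δ u θ z) {η : ℝ} (hu : ∀ s, |u s - 1| ≤ η) (hη : η ≤ 1 / 2)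
    (a C t s : ℝ) :
    ‖rigidMotion f e Ω V C (planarPart u θ) z t s
        - circleCurve f e (a * t) (δ / s₀ * (s - C * t) + Ω * t)‖
      ≤ η + 6 * s₀ + |V - a| * |t| := by
  set σ := s - C * t
  have hheight : |z σ| ≤ 2 * 1 * s₀ := by
    simpa [hturn.height_zero] using norm_sub_linear_le_of_add_period (δ := 0)
      (fun s => (h.hasDerivAt_height s).differentiableAt) h.abs_deriv_height_le hs₀
      (by simpa using hturn.periodic_height) σ
  have hangle : |θ σ - δ / s₀ * σ| ≤ 2 * 2 * s₀ := by
    have hquarter : ∀ s, 1 / 4 ≤ u s := fun s => by linarith [neg_abs_le (u s - 1), hu s]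
    simpa [hturn.angle_zero, div_mul_comm] using norm_sub_linear_le_of_add_period
      (fun s => (h.hasDerivAt_angle s).differentiableAt)
      (fun s => h.abs_deriv_angle_le (hquarter s)) hs₀ hturn.angle_add σ
  have hrot : Complex.exp ((Ω * t : ℝ) * Complex.I) * planarPart u θ σ
      = √(u σ) * Complex.exp ((θ σ + Ω * t : ℝ) * Complex.I) := by
    rw [planarPart, mul_left_comm, ← Complex.exp_add]
    push_cast
    ring_nf
  rw [rigidMotion, circleCurve, ← map_sub, Prod.mk_sub_mk, hrot]
  calc _ ≤ _ := hf.norm_frameMap_le _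
    _ ≤ (|u σ - 1| + |θ σ + Ω * t - (δ / s₀ * σ + Ω * t)|) + (|z σ| + |(V - a) * t|) := by
        refine add_le_add (norm_sqrt_mul_exp_sub_exp_le (h.pos σ).le _ _) ?_
        rw [add_sub_assoc, ← sub_mul]
        exact abs_add_le _ _
    _ ≤ (η + 2 * 2 * s₀) + (2 * 1 * s₀ + |V - a| * |t|) := by
        rw [add_sub_add_right_eq_sub, abs_mul]
        gcongr
        exact hu σ
    _ = _ := by ring

end ClosingUp

section CircleLimit

theorem frequently_eq_div_natCast {f : ℝ → ℝ} (hf : Continuous f) (h0 : f 0 = 0)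
    (hpos : ∀ᶠ q in 𝓝[>] 0, 0 < f q) {c : ℝ} (hc : 0 < c) :
    ∃ᶠ q in 𝓝[>] 0, ∃ n : ℕ, 0 < n ∧ f q = c / n := by
  refine (nhdsGT_basis (0 : ℝ)).frequently_iff.2 fun d hd => ?_
  obtain ⟨b, hfb, hb0, hbd⟩ := (hpos.and (Ioo_mem_nhdsGT hd)).exists
  obtain ⟨n, hn⟩ := exists_nat_gt (c / f b)
  have hnpos : (0 : ℝ) < n := (div_pos hc hfb).trans hn
  have hmem : c / n ∈ Set.Ioo (f 0) (f b) :=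
    ⟨h0.trans_lt (div_pos hc hnpos), (div_lt_comm₀ hfb hnpos).1 hn⟩
  obtain ⟨q, hq, hfq⟩ := intermediate_value_Ioo hb0.le hf.continuousOn hmem
  exact ⟨q, ⟨hq.1, hq.2.trans hbd⟩, n, Nat.cast_pos.1 hnpos, hfq⟩

theorem continuous_phasePeriod : Continuous phasePeriod :=
  intervalIntegral.continuous_parametric_intervalIntegral_of_continuous'
    (continuous_phaseSpeed_prod.inv₀ fun _ => (phaseSpeed_pos _ _).ne') _ _

theorem continuous_cosMoment : Continuous cosMoment := by
  refine intervalIntegral.continuous_parametric_intervalIntegral_of_continuous' ?_ _ _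
  refine Continuous.div (by fun_prop)
    (continuous_phaseSpeed_prod.mul (continuous_const.add continuous_phaseSpeed_prod)) fun p => ?_
  have hpos := phaseSpeed_pos p.1 p.2
  positivity

theorem continuous_drift : Continuous drift :=
  continuous_cosMoment.div continuous_phasePeriod fun q => (phasePeriod_pos q).ne'

theorem continuous_thirdRoot (v : ℝ) : Continuous (thirdRoot v) :=
  continuous_const.add (continuous_const.mul continuous_drift)

theorem continuous_midSqDist (v : ℝ) : Continuous (midSqDist v) :=
  continuous_const.sub ((continuous_pow 2).mul (continuous_thirdRoot v))

theorem continuous_angMom (v : ℝ) : Continuous (angMom v) :=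
  (((((continuous_midSqDist v).pow 2).sub (continuous_pow 2)).mul
    (continuous_thirdRoot v)).sqrt).div_const 2

theorem continuous_arcScaleSq (v : ℝ) : Continuous (arcScaleSq v) := by
  have hdrift := continuous_drift
  have hmid := continuous_midSqDist v
  have hmom := continuous_angMom v
  unfold arcScaleSq
  fun_prop

theorem continuous_sweptAngle (v : ℝ) : Continuous (sweptAngle v) := by
  have hmid := continuous_midSqDist v
  have hmom := continuous_angMom v
  refine intervalIntegral.continuous_parametric_intervalIntegral_of_continuous' ?_ _ _
  refine Continuous.div (continuous_const.add (.div ?_ ?_ fun p => ?_))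
    continuous_phaseSpeed_prod fun _ => (phaseSpeed_pos _ _).ne'
  · fun_prop
  · fun_prop
  positivity

theorem phasePeriod_zero : phasePeriod 0 = 2 * π := by
  simp [phasePeriod, phaseSpeed_zero]

theorem drift_zero : drift 0 = 1 / 4 := by
  have hmoment : cosMoment 0 = π / 2 := by
    norm_num [cosMoment, phaseSpeed_zero, intervalIntegral.integral_div, integral_cos_sq]
  rw [drift, phasePeriod_zero, hmoment]
  field_simp
  norm_num

theorem midSqDist_zero (v : ℝ) : midSqDist v 0 = 1 := by
  simp [midSqDist]

/-- The value of the parameter `v` for which the helical profiles, wound around the unit circle and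
closed up, have length close to `2 * π * m` as `q` tends to zero. -/
def windingParam (m : ℝ) : ℝ := (3 - m ^ 2) / (4 * √(m ^ 2 - 1))

/-- The length of `n` phase periods when `n` is determined by `n * (q * sweptAngle v q) = 2 * π`. -/
def closedLength (v q : ℝ) : ℝ := 2 * π * √(arcScaleSq v q) * phasePeriod q / sweptAngle v q

variable {m : ℝ}

theorem sqrt_sq_sub_one_pos (hm : 1 < m) : 0 < √(m ^ 2 - 1) :=
  sqrt_pos.2 (by nlinarith)

theorem angMom_windingParam_zero (hm : 1 < m) :
    angMom (windingParam m) 0 = (m ^ 2 + 1) / (8 * √(m ^ 2 - 1)) := by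
  have hpos := sqrt_sq_sub_one_pos hm
  have hsq : √(m ^ 2 - 1) ^ 2 = m ^ 2 - 1 := sq_sqrt (sqrt_pos.1 hpos).le
  have hsquare : (midSqDist (windingParam m) 0 ^ 2 - 0 ^ 2) * thirdRoot (windingParam m) 0
      = ((m ^ 2 + 1) / (4 * √(m ^ 2 - 1))) ^ 2 := by
    rw [midSqDist_zero, thirdRoot, drift_zero, windingParam]
    field_simp
    linear_combination 8 * hsq
  rw [angMom, hsquare, sqrt_sq (by positivity)]
  ring

theorem arcScaleSq_windingParam_zero (hm : 1 < m) :
    arcScaleSq (windingParam m) 0 = (m / (2 * √(m ^ 2 - 1))) ^ 2 := by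
  have hpos := sqrt_sq_sub_one_pos hm
  have hsq : √(m ^ 2 - 1) ^ 2 = m ^ 2 - 1 := sq_sqrt (sqrt_pos.1 hpos).le
  rw [arcScaleSq, angMom_windingParam_zero hm, midSqDist_zero, drift_zero, windingParam]
  field_simp
  linear_combination 768 * hsq

theorem sqrt_arcScaleSq_windingParam_zero (hm : 1 < m) :
    √(arcScaleSq (windingParam m) 0) = m / (2 * √(m ^ 2 - 1)) := by
  rw [arcScaleSq_windingParam_zero hm, sqrt_sq (by positivity)]

theorem sweptAngle_windingParam_zero (hm : 1 < m) :
    sweptAngle (windingParam m) 0 = π / √(m ^ 2 - 1) := by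
  have hpos := sqrt_sq_sub_one_pos hm
  simp only [sweptAngle, angMom_windingParam_zero hm, midSqDist_zero, phaseSpeed_zero, zero_mul,
    add_zero, div_one, intervalIntegral.integral_const, smul_eq_mul, sub_zero]
  rw [windingParam, max_eq_left (by norm_num)]
  field_simp
  ring

theorem tendsto_closedLength (hm : 1 < m) :
    Tendsto (closedLength (windingParam m)) (𝓝 0) (𝓝 (2 * π * m)) := by
  have hpos := sqrt_sq_sub_one_pos hm
  have hcont : ContinuousAt (closedLength (windingParam m)) 0 := by
    refine .div (.mul (.mul continuousAt_const (continuous_arcScaleSq _).sqrt.continuousAt)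
      continuous_phasePeriod.continuousAt) (continuous_sweptAngle _).continuousAt ?_
    rw [sweptAngle_windingParam_zero hm]
    positivity
  convert hcont.tendsto using 2
  rw [closedLength, sqrt_arcScaleSq_windingParam_zero hm, phasePeriod_zero,
    sweptAngle_windingParam_zero hm]
  field_simp

theorem tendsto_riseSpeed (hm : 1 < m) :
    Tendsto (riseSpeed (windingParam m)) (𝓝 0) (𝓝 (slowFactor m)) := by
  have hpos := sqrt_sq_sub_one_pos hm
  have hcont : ContinuousAt (riseSpeed (windingParam m)) 0 := by
    refine .div continuousAt_const (continuous_arcScaleSq _).sqrt.continuousAt ?_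
    rw [sqrt_arcScaleSq_windingParam_zero hm]
    positivity
  convert hcont.tendsto using 2
  rw [riseSpeed, sqrt_arcScaleSq_windingParam_zero hm, windingParam, slowFactor]
  field_simp
  ring

theorem eventually_isAdmissible (hm : 1 < m) :
    ∀ᶠ q in 𝓝[>] 0, IsAdmissible (windingParam m) q := by
  have hroot : √(m ^ 2 - 1) ≠ 0 := (sqrt_sq_sub_one_pos hm).ne'
  have hhalf : ∀ᶠ q : ℝ in 𝓝 0, q < 1 / 2 := eventually_lt_nhds (by norm_num)
  have hmid : ∀ᶠ q in 𝓝 0, 1 / 2 < midSqDist (windingParam m) q - q :=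
    ((continuous_midSqDist _).sub continuous_id).tendsto' 0 1 (by simp [midSqDist_zero])
      |>.eventually_const_lt (by norm_num)
  have hscale : ∀ᶠ q in 𝓝 0, 0 < arcScaleSq (windingParam m) q := by
    refine (continuous_arcScaleSq _).tendsto 0 |>.eventually_const_lt ?_
    rw [arcScaleSq_windingParam_zero hm]
    positivity
  filter_upwards [self_mem_nhdsWithin, nhdsWithin_le_nhds hhalf, nhdsWithin_le_nhds hmid,
    nhdsWithin_le_nhds hscale] with q h1 h2 h3 h4 using ⟨h1, h2.le, h3.le, h4⟩

theorem frequently_mul_sweptAngle_eq_two_pi_div (hm : 1 < m) :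
    ∃ᶠ q in 𝓝[>] 0, ∃ n : ℕ, 0 < n ∧ q * sweptAngle (windingParam m) q = 2 * π / n := by
  refine frequently_eq_div_natCast (continuous_id.mul (continuous_sweptAngle _)) (zero_mul _) ?_
    two_pi_pos
  have hpos := sqrt_sq_sub_one_pos hm
  have hswept : ∀ᶠ q in 𝓝 0, 0 < sweptAngle (windingParam m) q := by
    refine (continuous_sweptAngle _).tendsto 0 |>.eventually_const_lt ?_
    rw [sweptAngle_windingParam_zero hm]
    positivity
  filter_upwards [self_mem_nhdsWithin, nhdsWithin_le_nhds hswept] with q hq hs using mul_pos hq hs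

/-- The bound on `q ^ 2 * thirdRoot v q + q` controls the distance of the profile to the cylinder of
radius one, the bound on the phase period its oscillation along the cylinder. -/
theorem exists_isAdmissible_closed (hm : 1 < m) {ε : ℝ} (hε : 0 < ε) :
    ∃ (q : ℝ) (n : ℕ), IsAdmissible (windingParam m) q ∧ 0 < n ∧
      n * (q * sweptAngle (windingParam m) q) = 2 * π ∧
      q ^ 2 * thirdRoot (windingParam m) q + q < ε ∧
      q * √(arcScaleSq (windingParam m) q) * phasePeriod q < ε ∧
      |n * (q * √(arcScaleSq (windingParam m) q) * phasePeriod q) - 2 * π * m| < ε ∧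
      |riseSpeed (windingParam m) q - slowFactor m| < ε := by
  set v := windingParam m
  have hroot := continuous_thirdRoot v
  have hscale := continuous_arcScaleSq v
  have hphase := continuous_phasePeriod
  have hradius : ∀ᶠ q in 𝓝 0, q ^ 2 * thirdRoot v q + q < ε :=
    (Continuous.tendsto' (by fun_prop) 0 0 (by simp)).eventually_lt_const hε
  have hperiod : ∀ᶠ q in 𝓝 0, q * √(arcScaleSq v q) * phasePeriod q < ε :=
    (Continuous.tendsto' (by fun_prop) 0 0 (by simp)).eventually_lt_const hε
  have hlength : ∀ᶠ q in 𝓝 0, |closedLength v q - 2 * π * m| < ε :=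
    (tendsto_closedLength hm).eventually (Metric.ball_mem_nhds _ hε)
  have hspeed : ∀ᶠ q in 𝓝 0, |riseSpeed v q - slowFactor m| < ε :=
    (tendsto_riseSpeed hm).eventually (Metric.ball_mem_nhds _ hε)
  obtain ⟨q, ⟨n, hn, hclosed⟩, hadm, hclose⟩ :=
    ((frequently_mul_sweptAngle_eq_two_pi_div hm).and_eventually
      ((eventually_isAdmissible hm).and (nhdsWithin_le_nhds
        (hradius.and (hperiod.and (hlength.and hspeed)))))).exists
  have hturn : n * (q * sweptAngle v q) = 2 * π := by
    rw [hclosed]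
    field_simp
  have hswept : sweptAngle v q ≠ 0 := fun h0 => two_pi_pos.ne' (by simpa [h0] using hturn.symm)
  have hL : n * (q * √(arcScaleSq v q) * phasePeriod q) = closedLength v q := by
    rw [closedLength, ← hturn]
    field_simp
  exact ⟨q, n, hadm, hn, hturn, hclose.1, hclose.2.1, hL ▸ hclose.2.2.1, hclose.2.2.2⟩

theorem exists_isSmoothSolution_near_circleCurve {f e : E3} (hf : IsFrame f e) (hm : 1 < m)
    {ε : ℝ} (hε : 0 < ε) :
    ∃ (L : ℝ) (Γ : ℝ → ℝ → E3), 0 < L ∧ IsSmoothSolution L Γ ∧ |L - 2 * π * m| < ε ∧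
      ∀ t, ∃ α, ∀ s,
        ‖Γ t s - circleCurve f e (slowFactor m * t) (2 * π / L * s + α)‖ ≤ ε * (7 + |t|) := by
  obtain ⟨q, n, hadm, hn, hclosed, hradius, hperiod, hlength, hspeed⟩ :=
    exists_isAdmissible_closed hm (ε := min ε (1 / 2)) (by positivity)
  simp only [lt_min_iff] at hradius hperiod hlength hspeed
  obtain ⟨u, θ, z, hprofile, hturn, hu⟩ := hadm.exists_isHelicalProfile
  set v := windingParam m
  set s₀ := q * √(arcScaleSq v q) * phasePeriod q
  have hs₀ : 0 < s₀ :=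
    mul_pos (mul_pos hadm.pos (sqrt_pos.2 hadm.arcScaleSq_pos)) (phasePeriod_pos q)
  have hu1 : ∀ s, |u s - 1| ≤ q ^ 2 * thirdRoot v q + q := fun s => by
    have hmid : |midSqDist v q - 1| = q ^ 2 * thirdRoot v q := by
      rw [midSqDist, sub_sub_cancel_left, abs_neg, abs_of_nonneg]
      exact mul_nonneg (sq_nonneg q) (thirdRoot_nonneg v q)
    linarith [abs_sub_le (u s) (midSqDist v q) 1, hu s]
  refine ⟨n * s₀, _, by positivity, hprofile.isRigidProfile.isSmoothSolution hf
    (hturn.periodic_planarPart hclosed) (hturn.periodic_height.nat_mul n), hlength.1,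
    fun t => ⟨rotSpeed v q * t - 2 * π / (n * s₀)
      * ((rotSpeed v q * angleConst v q + riseSpeed v q * heightConst v q) * t), fun s => ?_⟩⟩
  have hclose := norm_rigidMotion_sub_circleCurve_le hf hprofile hs₀ hturn hu1 hradius.2.le
    (slowFactor m) (rotSpeed v q * angleConst v q + riseSpeed v q * heightConst v q) t s
  have hfreq : q * sweptAngle v q / s₀ = 2 * π / (n * s₀) := by
    rw [← hclosed]
    field_simp
  rw [hfreq, mul_sub, sub_add_eq_add_sub, add_sub_assoc] at hclose
  refine hclose.trans ?_
  nlinarith [mul_le_mul_of_nonneg_right hspeed.1.le (abs_nonneg t), hradius.1, hperiod.1]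

end CircleLimit

section Work

variable {E : Type*} [NormedAddCommGroup E] [InnerProductSpace ℝ E]

/-- The work of the vector field `X` along the curve `c` over the parameter interval `[0, ℓ]`; the
current of a curve evolution at a fixed time is the work along the curve at that time. -/
def work (X : E → E) (c : ℝ → E) (ℓ : ℝ) : ℝ := ∫ s in (0 : ℝ)..ℓ, ⟪X (c s), deriv c s⟫_ℝ

variable {X : E → E} {c d : ℝ → E} {ℓ : ℝ}

/-- Integrating by parts moves the derivative of `c - d` to `X ∘ d`; the boundary terms cancel since
both curves are closed. -/
theorem work_sub_work (hX : ContDiff ℝ 1 X) (hc : ContDiff ℝ 1 c) (hd : ContDiff ℝ 1 d)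
    (hc' : c ℓ = c 0) (hd' : d ℓ = d 0) :
    work X c ℓ - work X d ℓ = ∫ s in (0 : ℝ)..ℓ,
      (⟪X (c s) - X (d s), deriv c s⟫_ℝ - ⟪fderiv ℝ X (d s) (deriv d s), c s - d s⟫_ℝ) := by
  have hcc := hc.continuous
  have hdc := hd.continuous
  have hXc := hX.continuous
  have hcd : Continuous (deriv c) := hc.continuous_deriv_one
  have hdd : Continuous (deriv d) := hd.continuous_deriv_one
  have hXd : Continuous fun s => fderiv ℝ X (d s) (deriv d s) :=
    ((hX.continuous_fderiv one_ne_zero).comp hdc).clm_apply hdd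
  have hprod : ∀ s, HasDerivAt (fun s => ⟪X (d s), c s - d s⟫_ℝ)
      (⟪X (d s), deriv c s - deriv d s⟫_ℝ + ⟪fderiv ℝ X (d s) (deriv d s), c s - d s⟫_ℝ) s :=
    fun s => ((hX.differentiable one_ne_zero (d s)).hasFDerivAt.comp_hasDerivAt s
      (hd.differentiable one_ne_zero s).hasDerivAt).inner ℝ
      ((hc.differentiable one_ne_zero s).hasDerivAt.sub
        (hd.differentiable one_ne_zero s).hasDerivAt)
  have hparts := intervalIntegral.integral_eq_sub_of_hasDerivAt (a := 0) (b := ℓ)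
    (fun s _ => hprod s) (Continuous.intervalIntegrable (by fun_prop) _ _)
  rw [hc', hd', sub_self] at hparts
  rw [work, work, ← intervalIntegral.integral_sub
    (Continuous.intervalIntegrable (by fun_prop) _ _)
    (Continuous.intervalIntegrable (by fun_prop) _ _), ← sub_eq_zero,
    ← intervalIntegral.integral_sub (Continuous.intervalIntegrable (by fun_prop) _ _)
    (Continuous.intervalIntegrable (by fun_prop) _ _), ← hparts]
  congr 1 with s
  simp only [inner_sub_left, inner_sub_right]
  ring

theorem abs_work_sub_work_le (hX : ContDiff ℝ 1 X) {k : NNReal} (hk : LipschitzWith k X)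
    (hc : ContDiff ℝ 1 c) (hd : ContDiff ℝ 1 d) (hc' : c ℓ = c 0) (hd' : d ℓ = d 0) (hℓ : 0 ≤ ℓ)
    {η A B : ℝ} (hA : ∀ s, ‖deriv c s‖ ≤ A) (hB : ∀ s, ‖deriv d s‖ ≤ B)
    (hη : ∀ s, ‖c s - d s‖ ≤ η) :
    |work X c ℓ - work X d ℓ| ≤ k * η * (A + B) * ℓ := by
  have hη0 : 0 ≤ η := (norm_nonneg _).trans (hη 0)
  have hpointwise : ∀ s,
      ‖⟪X (c s) - X (d s), deriv c s⟫_ℝ - ⟪fderiv ℝ X (d s) (deriv d s), c s - d s⟫_ℝ‖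
        ≤ k * η * (A + B) := fun s =>
    calc _ ≤ ‖X (c s) - X (d s)‖ * ‖deriv c s‖
          + ‖fderiv ℝ X (d s)‖ * ‖deriv d s‖ * ‖c s - d s‖ := by
          refine (norm_sub_le _ _).trans (add_le_add (norm_inner_le_norm _ _) ?_)
          refine (norm_inner_le_norm _ _).trans ?_
          gcongr
          exact ContinuousLinearMap.le_opNorm _ _
      _ ≤ (k * η) * A + k * B * η := by
          have hfield : ‖X (c s) - X (d s)‖ ≤ k * η :=
            (hk.norm_sub_le _ _).trans (mul_le_mul_of_nonneg_left (hη s) k.2)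
          have hB0 : 0 ≤ B := (norm_nonneg _).trans (hB s)
          gcongr
          exacts [hA s, norm_fderiv_le_of_lipschitz ℝ hk, hB s, hη s]
      _ = k * η * (A + B) := by ring
  rw [work_sub_work hX hc hd hc' hd']
  simpa [abs_of_nonneg hℓ] using
    intervalIntegral.norm_integral_le_of_norm_le_const (a := 0) (b := ℓ) fun s _ => hpointwise s

theorem deriv_comp_mul_add (c : ℝ → E) (k α : ℝ) :
    deriv (fun s => c (k * s + α)) = fun s => k • deriv c (k * s + α) := by
  ext1 s
  rw [deriv_comp_mul_left k (fun s => c (s + α)), deriv_comp_add_const]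

theorem work_comp_mul_add (X : E → E) {T k : ℝ} (hc : Function.Periodic c T) (hk : k * ℓ = T)
    (α : ℝ) : work X (fun s => c (k * s + α)) ℓ = work X c T := by
  have hderiv : Function.Periodic (deriv c) T := fun s => by
    rw [← deriv_comp_add_const, funext hc]
  have hper : Function.Periodic (fun s => ⟪X (c s), deriv c s⟫_ℝ) T := fun s => by
    simp only [hc s, hderiv s]
  simp only [work, deriv_comp_mul_add, real_inner_smul_right]
  rw [intervalIntegral.integral_const_mul,
    intervalIntegral.mul_integral_comp_mul_add (f := fun s => ⟪X (c s), deriv c s⟫_ℝ), hk, mul_zero,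
    zero_add, add_comm, hper.intervalIntegral_add_eq α 0, zero_add]

theorem abs_work_sub_work_le_of_unit_speed (hX : ContDiff ℝ 1 X) {k : NNReal}
    (hk : LipschitzWith k X) (hc : ContDiff ℝ 1 c) (hd : ContDiff ℝ 1 d) {L : ℝ}
    (hcL : Function.Periodic c L) (hdℓ : Function.Periodic d ℓ) (hL : 0 < L) (hℓ : 0 ≤ ℓ)
    (hc1 : ∀ s, ‖deriv c s‖ = 1) (hd1 : ∀ s, ‖deriv d s‖ = 1) {α η : ℝ}
    (hη : ∀ s, ‖c s - d (ℓ / L * s + α)‖ ≤ η) :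
    |work X c L - work X d ℓ| ≤ k * η * (L + ℓ) := by
  have hclosed : ℓ / L * L = ℓ := div_mul_cancel₀ ℓ hL.ne'
  rw [← work_comp_mul_add X hdℓ hclosed α]
  refine (abs_work_sub_work_le hX hk hc (d := fun s => d (ℓ / L * s + α))
    (hd.comp (by fun_prop)) hcL.eq ?_ hL.le (B := ℓ / L)
    (fun s => (hc1 s).le) (fun s => ?_) hη).trans_eq (by field_simp)
  · rw [hclosed, mul_zero, zero_add, add_comm, hdℓ]
  · rw [deriv_comp_mul_add, norm_smul, hd1, mul_one, norm_of_nonneg (by positivity)]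

theorem tendstoDistrib_current {γ : ℝ → ℝ → E3} (hγ : IsSmoothSolution ℓ γ) (hℓ : 0 ≤ ℓ)
    {ℓn η : ℕ → ℝ} {γn : ℕ → ℝ → ℝ → E3} (hγn : ∀ n, IsSmoothSolution (ℓn n) (γn n))
    (hℓn : ∀ n, 0 < ℓn n) {ℓlim : ℝ} (hlim : Tendsto ℓn atTop (𝓝 ℓlim))
    (hη : Tendsto η atTop (𝓝 0)) {t t' : ℝ}
    (hclose : ∀ n, ∃ α, ∀ s, ‖γn n t s - γ t' (ℓ / ℓn n * s + α)‖ ≤ η n) :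
    TendstoDistrib (fun n => current (ℓn n) (γn n) t) (current ℓ γ t') := by
  intro X
  have hX : ContDiff ℝ 1 X := X.contDiff.of_le (by exact_mod_cast le_top)
  obtain ⟨k, hk⟩ := hX.lipschitzWith_of_hasCompactSupport X.hasCompactSupport one_ne_zero
  have hbound : Tendsto (fun n => k * η n * (ℓn n + ℓ)) atTop (𝓝 0) := by
    simpa using (hη.const_mul (k : ℝ)).mul (hlim.add_const ℓ)
  refine tendsto_iff_dist_tendsto_zero.2 (squeeze_zero (fun _ => dist_nonneg) (fun n => ?_) hbound)
  obtain ⟨α, hα⟩ := hclose n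
  exact abs_work_sub_work_le_of_unit_speed hX hk (((hγn n).contDiff_curve t).of_le (by simp))
    ((hγ.contDiff_curve t').of_le (by simp)) ((hγn n).periodic t) (hγ.periodic t') (hℓn n) hℓ
    ((hγn n).arclength t) (hγ.arclength t') hα

end Work

theorem IsTravelingCircle.exists_isSmoothSolution_near {ℓ m ε : ℝ} {γ : ℝ → ℝ → E3}
    (hcirc : IsTravelingCircle (ℓ / (2 * π)) γ) (h : IsSmoothSolution ℓ γ) (hℓ : 0 < ℓ)
    (hm : 1 < m) (hε : 0 < ε) :
    ∃ (L : ℝ) (Γ : ℝ → ℝ → E3), 0 < L ∧ IsSmoothSolution L Γ ∧ |L - m * ℓ| ≤ ℓ / (2 * π) * ε ∧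
      ∀ t, ∃ α, ∀ s, ‖Γ t s - γ (slowFactor m * t) (ℓ / L * s + α)‖
        ≤ ε * (ℓ / (2 * π) * (7 + |(ℓ / (2 * π))⁻¹ ^ 2 * t|)) := by
  set r := ℓ / (2 * π) with hr
  have hrpos : 0 < r := by positivity
  have hℓr : ℓ = r * (2 * π) := by rw [hr]; field_simp
  obtain ⟨p, f, e, hf, rfl⟩ := hcirc.exists_eq_rescale h hrpos
  obtain ⟨L, Γ, hL, hΓ, hlength, hclose⟩ := exists_isSmoothSolution_near_circleCurve hf hm hε
  refine ⟨r * L, rescale p r Γ, mul_pos hrpos hL, hΓ.rescale p hrpos.ne', ?_, fun t => ?_⟩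
  · rw [hℓr, show r * L - m * (r * (2 * π)) = r * (L - 2 * π * m) by ring, abs_mul,
      abs_of_pos hrpos]
    gcongr
  · obtain ⟨α, hα⟩ := hclose (r⁻¹ ^ 2 * t)
    refine ⟨r * α, fun s => ?_⟩
    have htime : r⁻¹ ^ 2 * (slowFactor m * t) = slowFactor m * (r⁻¹ ^ 2 * t) := by ring
    have hangle : r⁻¹ * (ℓ / (r * L) * s + r * α) = 2 * π / L * (r⁻¹ * s) + α := by
      rw [hℓr]
      field_simp
    rw [rescale, rescale, add_sub_add_left_eq_sub, ← smul_sub, norm_smul, norm_of_nonneg hrpos.le,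
      htime, hangle, mul_left_comm ε r]
    exact mul_le_mul_of_nonneg_left (hα (r⁻¹ * s)) hrpos.le

end BinormalFlow

end

/-- A circle of length `ℓ` traveling by the binormal curvature flow, slowed by the factor `a_m`, is,
for every `m > 1`, a limit in the sense of distributions of smooth binormal curvature flows of
closed curves whose lengths tend to `m ℓ`. -/
theorem mainTheorem11 (ℓ : ℝ) (hℓ : 0 < ℓ) (γ : ℝ → ℝ → BinormalFlow.E3)
    (hsol : BinormalFlow.IsSmoothSolution ℓ γ)
    (hcirc : BinormalFlow.IsTravelingCircle (ℓ / (2 * Real.pi)) γ)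
    (m : ℝ) (hm : 1 < m) :
    ∃ (ℓn : ℕ → ℝ) (γn : ℕ → ℝ → ℝ → BinormalFlow.E3),
      (∀ n, 0 < ℓn n) ∧
      (∀ n, BinormalFlow.IsSmoothSolution (ℓn n) (γn n)) ∧
      Filter.Tendsto ℓn Filter.atTop (nhds (m * ℓ)) ∧
      ∀ t : ℝ, BinormalFlow.TendstoDistrib
        (fun n => BinormalFlow.current (ℓn n) (γn n) t)
        (BinormalFlow.current ℓ γ (BinormalFlow.slowFactor m * t)) := by
  have hε : Filter.Tendsto (fun n : ℕ => 1 / ((n : ℝ) + 1)) Filter.atTop (nhds 0) :=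
    tendsto_one_div_add_atTop_nhds_zero_nat
  choose ℓn γn hpos hsoln hlength hclose using fun n : ℕ =>
    hcirc.exists_isSmoothSolution_near hsol hℓ hm (Nat.one_div_pos_of_nat (α := ℝ) (n := n))
  have hlim : Filter.Tendsto ℓn Filter.atTop (nhds (m * ℓ)) :=
    tendsto_iff_dist_tendsto_zero.2 <| squeeze_zero (fun _ => dist_nonneg) hlength
      (by simpa using hε.const_mul (ℓ / (2 * Real.pi)))
  refine ⟨ℓn, γn, hpos, hsoln, hlim, fun t => ?_⟩
  exact BinormalFlow.tendstoDistrib_current hsol hℓ.le hsoln hpos hlim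
    (by simpa using hε.mul_const _) fun n => hclose n t
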